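/- Let $\mathcal A=(Q,\Sigma,\Delta,Q_0,F)$ be a nondeterministic Büchi automaton (NBA) with finite state set $Q$. For $P\subseteq Q$ let $L(P)$ be the set of infinite words with a run that starts in $P$ and visits $F$ infinitely often, and write $L(p)=L(\{p\})$. **The construction.** A macrostate is a pair $(\alpha,t)$, where $t=(S_1,\dots,S_n)$ is a tuple of pairwise disjoint subsets of $Q$ and $\alpha:[n]\to[n]$ is a bijection; $\alpha(i)$ is the rank of $S_i$. It is a ranked slice if all $S_i$ are nonempty. Let $Q_t=\bigcup_i S_i$, and let $\mathrm{idx}_t(q)$ be the $i$ with $q\in S_i$. The determinization construction starts in the tuple $(Q_0)$ with rank $1$ (in the empty tuple if $Q_0=\emptyset$). The successor of $(\alpha,t)$ on a letter $a$ is obtained as follows. 1. *step*: each $S_i$ is replaced by the two sets $\hat S_{2i-1}=T_i\cap F$ and $\hat S_{2i}=T_i\setminus F$, where $T_i=\Delta(S_i,a)\setminus\bigcup_{j<i}\Delta(S_j,a)$. The set $\hat S_{2i}$ inherits rank $\alpha(i)$; the sets $\hat S_{2i-1}$ get the fresh ranks $n+1,\dots,2n$ in any order. 2. *prune*: empty sets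 are removed; each nonempty set gets the smallest rank among its own rank and the ranks of the empty sets between it and the next nonempty set to its right. Let $G$ be the set of ranks that have been passed on from an empty to a nonempty set (good events), $R$ the set of ranks that have disappeared (bad events), and $k=\min(G\cup R)$, with $k=|Q|+1$ if $G\cup R=\emptyset$. The transition has priority $2k$ if $k\in G$ and $2k-1$ otherwise. 3. *merge*: the tuple is cut into intervals, and each interval is replaced by the union of its sets, with the smallest rank of the interval. The cut is arbitrary, except that in an interval with more than one set all ranks are at least $k$, and all ranks except that of the rightmost set are greater than $k$. 4. *normalize*: the ranks are replaced by $1,\dots,n'$ in an order-preserving way. Every choice of the fresh ranks and of the cut, for each macrostate and letter, gives a deterministic parity automaton (DPA); it accepts a word if the smallest priority that occurs infinitely often is even. *Omitting* a set $D\subseteq Q$ from $(\alpha,t)$ means replacing each $S_i$ by $S_i\setminus D$ and keeping $\alpha$; a set that becomes empty keeps its place and its rank until it is removed by *prune* in the next transition. **Theorem.** For every ranked slice $(\alpha,t)$ let $D(\alpha,t)\subseteq Q_t$ be a (possibly empty) set of states such that for every $p\in D(\alpha,t)$ there is a state $q\in Q_t$ with $L(p)\subseteq L(q)$ and $\mathrm{idx}_t(q)<\mathrm{idx}_t(p)$.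 If the construction is modified so that $D(\alpha,t)$ is omitted from every macrostate $(\alpha,t)$ as soon as it is constructed, then the resulting DPA recognizes the same language as the DPA of the unmodified construction, however the freedom in the two constructions is resolved. In particular, a single state $p$ may be omitted from a single macrostate that contains $p$ and a state $q$ with $L(p)\subseteq L(q)$ in a set further to the left. -/

import Mathlib

open Filter

/-- A nondeterministic Büchi automaton with state set `Q` over the alphabet `X`. -/
structure NBA (Q X : Type*) where
  /-- `next p a` is the set of `a`-successors of `p`. -/
  next : Q → X → Finset Q
  /-- The initial states. -/
  start : Finset Q
  /-- The accepting states. -/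
  acc : Finset Q

namespace NBA

variable {Q X : Type*}

/-- `ρ` is a run on the word `w` that starts in the set `P`. -/
def IsRun (A : NBA Q X) (P : Finset Q) (w : ℕ → X) (ρ : ℕ → Q) : Prop :=
  ρ 0 ∈ P ∧ ∀ i, ρ (i + 1) ∈ A.next (ρ i) (w i)

/-- The language `L(P)`: the words with a run from `P` that visits accepting states infinitely
often. -/
def lang (A : NBA Q X) (P : Finset Q) : Set (ℕ → X) :=
  {w | ∃ ρ, A.IsRun P w ρ ∧ ∃ᶠ i in atTop, ρ i ∈ A.acc}

end NBA

/-- A complete deterministic automaton with a finite set `M` of states over the alphabet `X`, and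
with priorities on the transitions (min-even parity acceptance). -/
structure DPA (M X : Type*) [Finite M] where
  /-- The initial state. -/
  start : M
  /-- The successor of a state on a letter. -/
  next : M → X → M
  /-- The priority of the transition that leaves a state on a letter. -/
  prio : M → X → ℕ

namespace DPA

variable {M X : Type*} [Finite M]

/-- The run of the automaton on a word. -/
def run (B : DPA M X) (w : ℕ → X) : ℕ → M
  | 0 => B.start
  | i + 1 => B.next (B.run w i) (w i)

/-- A word is accepted if the smallest priority that occurs infinitely often along the run is
even. -/
def lang (B : DPA M X) : Set (ℕ → X) :=
  {w | ∃ k, Even k ∧ IsLeast {k | ∃ᶠ i in atTop, B.prio (B.run w i) (w i) = k} k}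

end DPA

/-- A tuple of sets of states, each with a rank, listed from left to right. -/
abbrev RankedTuple (Q : Type*) := List (Finset Q × ℕ)

namespace RankedTuple

variable {Q X : Type*}

theorem foldr_min_mem (l : RankedTuple Q) (r : ℕ) :
    l.foldr (fun e k => min e.2 k) r ∈ r :: l.map Prod.snd := by
  induction l with
  | nil => simp
  | cons x l ih =>
    rcases min_choice x.2 (l.foldr (fun e k => min e.2 k) r) with h | h
    · simp [h]
    · rw [List.foldr_cons, h]
      rcases List.mem_cons.1 ih with h' | h'
      · rw [h']; simp
      · exact List.mem_cons_of_mem _ (List.mem_cons_of_mem _ h')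

theorem merge_rank_mem {b : RankedTuple Q} (hb : b ≠ []) :
    (b.map Prod.snd).min?.getD 0 ∈ b.map Prod.snd := by
  rcases h : (b.map Prod.snd).min? with _ | k
  · simp [List.min?_eq_none_iff] at h
    exact absurd h hb
  · exact List.min?_mem h

variable [DecidableEq Q]

/-- The set of states that occur in the tuple. -/
def states (t : RankedTuple Q) : Finset Q := t.foldr (fun e U => e.1 ∪ U) ∅

/-- The ranks that occur in the tuple. -/
def ranks (t : RankedTuple Q) : Finset ℕ := (t.map Prod.snd).toFinset

/-- The (zero-based) position of the set that contains `q`. -/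
def idx (t : RankedTuple Q) (q : Q) : ℕ := t.findIdx (fun e => decide (q ∈ e.1))

/-- Deletes the states of `D` from all sets of the tuple. The ranks stay, and a set that becomes
empty keeps its place. -/
def without (t : RankedTuple Q) (D : Finset Q) : RankedTuple Q := t.map fun e => (e.1 \ D, e.2)

/-- Auxiliary function for `step`: `seen` holds the states reached from the sets further left, the
list of numbers holds the fresh ranks still to be assigned. -/
def stepAux (A : NBA Q X) (a : X) : Finset Q → List ℕ → RankedTuple Q → RankedTuple Q
  | seen, f :: fs, (S, r) :: t =>
    let T := S.biUnion (fun p => A.next p a) \ seen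
    (T ∩ A.acc, f) :: (T \ A.acc, r) :: stepAux A a (seen ∪ T) fs t
  | _, _, _ => []

/-- Operation `step`: every set is replaced by its set of `a`-successors, only the leftmost
occurrence of each state is kept, and the accepting states are separated to the left. The
non-accepting part inherits the rank, the accepting part gets a fresh rank. -/
def step (A : NBA Q X) (a : X) (fresh : List ℕ) (t : RankedTuple Q) : RankedTuple Q :=
  stepAux A a ∅ fresh t

/-- Operation `prune`: empty sets are removed. A nonempty set gets the smallest rank among its own
rank and the ranks of the empty sets between it and the next nonempty set on its right. -/
def prune : RankedTuple Q → RankedTuple Q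
  | [] => []
  | (S, r) :: t =>
    if S = ∅ then prune t
    else (S, (t.takeWhile (fun e => decide (e.1 = ∅))).foldr (fun e k => min e.2 k) r) :: prune t

/-- The ranks with a good event in `prune`: their set was empty, and they were passed on to a
nonempty set. -/
def good (t : RankedTuple Q) : Finset ℕ := (prune t).ranks.filter (fun k => (∅, k) ∈ t)

/-- The ranks with a bad event in `prune`: they disappear. -/
def bad (t : RankedTuple Q) : Finset ℕ := t.ranks \ (prune t).ranks

/-- The dominating rank of a transition: the smallest rank with an event in `prune`, or `|Q| + 1` if
there is none. -/
def domRank [Fintype Q] (t : RankedTuple Q) : ℕ :=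
  (good t ∪ bad t).min.untopD (Fintype.card Q + 1)

/-- The priority of a transition. -/
def priority [Fintype Q] (t : RankedTuple Q) : ℕ :=
  if domRank t ∈ good t then 2 * domRank t else 2 * domRank t - 1

/-- `bs` cuts the tuple `t` into intervals that may be merged when the dominating rank is `k`: only
sets of rank at least `k` are merged with other sets, and the set of rank `k` (which exists if the
dominating event is good) is merged only with sets on its left. -/
def IsGrouping (k : ℕ) (t : RankedTuple Q) (bs : List (RankedTuple Q)) : Prop :=
  bs.flatten = t ∧ ∀ b ∈ bs, b ≠ [] ∧
    (b.length = 1 ∨ (∀ e ∈ b.dropLast, k < e.2) ∧ ∀ e ∈ b.getLast?, k ≤ e.2)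

/-- Operation `merge`: every interval becomes one set with the smallest rank of the interval. -/
def merge (bs : List (RankedTuple Q)) : RankedTuple Q :=
  bs.map fun b => (b.states, (b.map Prod.snd).min?.getD 0)

/-- Operation `normalize`: the ranks are replaced by `1, …, n` in an order-preserving way. -/
def normalize (t : RankedTuple Q) : RankedTuple Q :=
  t.map fun e => (e.1, t.countP (fun e' => decide (e'.2 ≤ e.2)))

/-- The sets are pairwise disjoint, and the ranks are a bijection from the `n` positions of the tuple
to `1, …, n`. Some sets may be empty, but there are at most `|Q|` positions. -/
structure IsPreSlice [Fintype Q] (t : RankedTuple Q) : Prop where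
  disjoint : t.Pairwise (fun e e' => Disjoint e.1 e'.1)
  nodup : (t.map Prod.snd).Nodup
  rank_mem : ∀ e ∈ t, 1 ≤ e.2 ∧ e.2 ≤ t.length
  length_le : t.length ≤ Fintype.card Q

/-- A ranked slice: moreover, all sets are nonempty. -/
structure IsSlice [Fintype Q] (t : RankedTuple Q) : Prop extends IsPreSlice t where
  nonempty : ∀ e ∈ t, e.1 ≠ ∅

theorem length_le_card [Fintype Q] (t : RankedTuple Q)
    (hd : t.Pairwise (fun e e' => Disjoint e.1 e'.1)) (hn : ∀ e ∈ t, e.1 ≠ ∅) :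
    t.length ≤ Fintype.card Q := by
  have key : t.length ≤ (states t).card := by
    induction t with
    | nil => simp
    | cons e t ih =>
      have h1 := ih (List.pairwise_cons.1 hd).2 (fun x hx => hn x (List.mem_cons_of_mem _ hx))
      have h2 : Disjoint e.1 (states t) := by
        have h3 := (List.pairwise_cons.1 hd).1
        clear ih hn h1 hd
        induction t with
        | nil => simp [states]
        | cons x t ih =>
          have h4 := ih (fun y hy => h3 y (List.mem_cons_of_mem _ hy))
          have h5 := h3 x List.mem_cons_self
          simpa [states, Finset.disjoint_union_right] using And.intro h5 h4
      have h6 : 0 < e.1.card := Finset.card_pos.2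
        (Finset.nonempty_iff_ne_empty.2 (hn e List.mem_cons_self))
      have h7 : states (e :: t) = e.1 ∪ states t := rfl
      rw [h7, Finset.card_union_of_disjoint h2, List.length_cons]
      omega
  exact key.trans (Finset.card_le_univ _)

theorem stepAux_disjoint (A : NBA Q X) (a : X) (t : RankedTuple Q) (fs : List ℕ) (U : Finset Q) :
    (∀ e ∈ stepAux A a U fs t, Disjoint U e.1) ∧
      (stepAux A a U fs t).Pairwise (fun e e' => Disjoint e.1 e'.1) := by
  induction t generalizing fs U with
  | nil => cases fs <;> simp [stepAux]
  | cons x t ih =>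
    obtain ⟨S, r⟩ := x
    cases fs with
    | nil => simp [stepAux]
    | cons f fs =>
      simp only [stepAux]
      set T := S.biUnion (fun p => A.next p a) \ U with hT
      obtain ⟨h1, h2⟩ := ih fs (U ∪ T)
      have hUT : Disjoint U T := Finset.disjoint_sdiff
      refine ⟨?_, ?_⟩
      · intro e he
        rcases List.mem_cons.1 he with rfl | he
        · exact hUT.mono_right Finset.inter_subset_left
        rcases List.mem_cons.1 he with rfl | he
        · exact hUT.mono_right Finset.sdiff_subset
        · exact (h1 e he).mono_left Finset.subset_union_left
      · refine List.pairwise_cons.2 ⟨?_, List.pairwise_cons.2 ⟨?_, h2⟩⟩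
        · intro e he
          rcases List.mem_cons.1 he with rfl | he
          · exact Finset.disjoint_sdiff.mono_left Finset.inter_subset_right
          · exact (h1 e he).mono_left
              (Finset.inter_subset_left.trans Finset.subset_union_right)
        · intro e he
          exact (h1 e he).mono_left (Finset.sdiff_subset.trans Finset.subset_union_right)

theorem stepAux_ranks (A : NBA Q X) (a : X) (t : RankedTuple Q) (fs : List ℕ) (U : Finset Q) :
    (∀ e ∈ stepAux A a U fs t, e.2 ∈ fs ∨ e.2 ∈ t.map Prod.snd) ∧
      ((t.map Prod.snd).Nodup → fs.Nodup → fs.Disjoint (t.map Prod.snd) →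
        ((stepAux A a U fs t).map Prod.snd).Nodup) := by
  induction t generalizing fs U with
  | nil => cases fs <;> simp [stepAux]
  | cons x t ih =>
    obtain ⟨S, r⟩ := x
    cases fs with
    | nil => simp [stepAux]
    | cons f fs =>
      simp only [stepAux]
      set T := S.biUnion (fun p => A.next p a) \ U with hT
      obtain ⟨h1, h2⟩ := ih fs (U ∪ T)
      refine ⟨?_, ?_⟩
      · intro e he
        rcases List.mem_cons.1 he with rfl | he
        · simp
        rcases List.mem_cons.1 he with rfl | he
        · simp
        · rcases h1 e he with h | h
          · exact Or.inl (List.mem_cons_of_mem _ h)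
          · exact Or.inr (List.mem_cons_of_mem _ h)
      · intro ht hf hd
        rw [List.map_cons, List.nodup_cons] at ht
        rw [List.nodup_cons] at hf
        rw [List.map_cons] at hd
        have hd1 : ∀ y, y ∈ f :: fs → y ≠ r ∧ y ∉ t.map Prod.snd := by
          intro y hy
          have := hd hy
          simpa [not_or] using this
        have h3 := h2 ht.2 hf.2 (fun y hy hy' => (hd1 y (List.mem_cons_of_mem _ hy)).2 hy')
        rw [List.map_cons, List.map_cons, List.nodup_cons, List.nodup_cons]
        refine ⟨?_, ?_, h3⟩
        · rw [List.mem_cons, not_or]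
          refine ⟨(hd1 f List.mem_cons_self).1, ?_⟩
          intro hm
          obtain ⟨e, he, hef⟩ := List.mem_map.1 hm
          rcases h1 e he with h | h
          · simp only at hef
            rw [hef] at h
            exact hf.1 h
          · simp only at hef
            rw [hef] at h
            exact (hd1 f List.mem_cons_self).2 h
        · intro hm
          obtain ⟨e, he, hef⟩ := List.mem_map.1 hm
          rcases h1 e he with h | h
          · exact (hd1 e.2 (List.mem_cons_of_mem _ h)).1 hef
          · exact ht.1 (hef ▸ h)

theorem prune_sets (t : RankedTuple Q) :
    (prune t).map Prod.fst = (t.map Prod.fst).filter (fun S => decide (S ≠ ∅)) := by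
  induction t with
  | nil => rfl
  | cons x t ih =>
    obtain ⟨S, r⟩ := x
    by_cases h : S = ∅ <;> simp [prune, h, ih]

theorem prune_dropWhile (t : RankedTuple Q) :
    prune (t.dropWhile (fun e => decide (e.1 = ∅))) = prune t := by
  induction t with
  | nil => rfl
  | cons x t ih =>
    obtain ⟨S, r⟩ := x
    by_cases h : S = ∅ <;> simp [prune, h, ih]

theorem prune_ranks_subset (t : RankedTuple Q) :
    ∀ k ∈ (prune t).map Prod.snd, k ∈ t.map Prod.snd := by
  induction t with
  | nil => simp [prune]
  | cons x t ih =>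
    obtain ⟨S, r⟩ := x
    intro k hk
    by_cases h : S = ∅
    · rw [prune, if_pos h] at hk
      exact List.mem_cons_of_mem _ (ih k hk)
    · rw [prune, if_neg h, List.map_cons] at hk
      rcases List.mem_cons.1 hk with hk | hk
      · have := foldr_min_mem (t.takeWhile (fun e => decide (e.1 = ∅))) r
        simp only at hk
        rw [← hk] at this
        rcases List.mem_cons.1 this with h' | h'
        · rw [h']; simp
        · exact List.mem_cons_of_mem _
            (((List.takeWhile_sublist _).map Prod.snd).subset h')
      · exact List.mem_cons_of_mem _ (ih k hk)

theorem prune_nodup (t : RankedTuple Q) (ht : (t.map Prod.snd).Nodup) :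
    ((prune t).map Prod.snd).Nodup := by
  induction t with
  | nil => simp [prune]
  | cons x t ih =>
    obtain ⟨S, r⟩ := x
    rw [List.map_cons, List.nodup_cons] at ht
    by_cases h : S = ∅
    · rw [prune, if_pos h]
      exact ih ht.2
    · rw [prune, if_neg h, List.map_cons, List.nodup_cons]
      refine ⟨?_, ih ht.2⟩
      intro hm
      rw [← prune_dropWhile] at hm
      have h1 := prune_ranks_subset _ _ hm
      rcases List.mem_cons.1 (foldr_min_mem (t.takeWhile (fun e => decide (e.1 = ∅))) r)
        with h2 | h2
      · rw [h2] at h1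
        exact ht.1 (((List.dropWhile_sublist _).map Prod.snd).subset h1)
      · have h3 := ht.2
        rw [← List.takeWhile_append_dropWhile (p := fun e : Finset Q × ℕ => decide (e.1 = ∅))
          (l := t), List.map_append, List.nodup_append'] at h3
        exact h3.2.2 h2 h1

theorem mem_states {t : RankedTuple Q} {q : Q} : q ∈ t.states ↔ ∃ e ∈ t, q ∈ e.1 := by
  induction t with
  | nil => simp [states]
  | cons x t ih =>
    have : states (x :: t) = x.1 ∪ states t := rfl
    rw [this, Finset.mem_union, ih]
    simp

theorem merge_props {k : ℕ} {t : RankedTuple Q} {bs : List (RankedTuple Q)}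
    (h : IsGrouping k t bs) (hd : t.Pairwise (fun e e' => Disjoint e.1 e'.1))
    (hr : (t.map Prod.snd).Nodup) (hn : ∀ e ∈ t, e.1 ≠ ∅) :
    (merge bs).Pairwise (fun e e' => Disjoint e.1 e'.1) ∧ ((merge bs).map Prod.snd).Nodup ∧
      ∀ e ∈ merge bs, e.1 ≠ ∅ := by
  obtain ⟨rfl, hb⟩ := h
  refine ⟨?_, ?_, ?_⟩
  · rw [List.pairwise_flatten] at hd
    rw [merge, List.pairwise_map]
    refine hd.2.imp ?_
    intro b b' hbb
    rw [Finset.disjoint_left]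
    intro q hq hq'
    obtain ⟨e, he, hqe⟩ := mem_states.1 hq
    obtain ⟨e', he', hqe'⟩ := mem_states.1 hq'
    exact Finset.disjoint_left.1 (hbb e he e' he') hqe hqe'
  · rw [List.map_flatten, List.nodup_flatten, List.pairwise_map] at hr
    rw [merge, List.map_map, List.Nodup, List.pairwise_map]
    refine hr.2.imp_of_mem ?_
    intro b b' hbm hbm' hbb heq
    refine hbb (merge_rank_mem (hb b hbm).1) ?_
    simp only [Function.comp] at heq
    rw [heq]
    exact merge_rank_mem (hb b' hbm').1
  · intro e he
    obtain ⟨b, hbm, rfl⟩ := List.mem_map.1 he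
    obtain ⟨x, hx⟩ := List.exists_mem_of_ne_nil b (hb b hbm).1
    obtain ⟨q, hq⟩ := Finset.nonempty_iff_ne_empty.2 (hn x (List.mem_flatten.2 ⟨b, hbm, hx⟩))
    exact Finset.nonempty_iff_ne_empty.1 ⟨q, mem_states.2 ⟨x, hx, hq⟩⟩

theorem normalize_isSlice [Fintype Q] {t : RankedTuple Q}
    (hd : t.Pairwise (fun e e' => Disjoint e.1 e'.1))
    (hr : (t.map Prod.snd).Nodup) (hn : ∀ e ∈ t, e.1 ≠ ∅) : IsSlice (normalize t) where
  disjoint := by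
    rw [normalize, List.pairwise_map]
    exact hd
  nodup := by
    have key : ∀ x ∈ t, ∀ y ∈ t, x.2 < y.2 →
        t.countP (fun e => decide (e.2 ≤ x.2)) < t.countP (fun e => decide (e.2 ≤ y.2)) := by
      intro x _ y hy hxy
      rw [List.countP_eq_length_filter, List.countP_eq_length_filter]
      have hsub : ((t.filter (fun e => decide (e.2 ≤ x.2))).Sublist
          (t.filter (fun e => decide (e.2 ≤ y.2)))) := by
        refine List.monotone_filter_right t ?_
        intro e he
        simp only [decide_eq_true_eq] at he ⊢
        omega
      refine lt_of_le_of_ne hsub.length_le ?_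
      intro hlen
      have heq := hsub.eq_of_length hlen
      have hmem : y ∈ t.filter (fun e => decide (e.2 ≤ y.2)) := by simp [hy]
      rw [← heq] at hmem
      simp only [List.mem_filter, decide_eq_true_eq] at hmem
      omega
    rw [normalize, List.map_map, List.Nodup, List.pairwise_map]
    rw [List.Nodup, List.pairwise_map] at hr
    refine hr.imp_of_mem ?_
    intro x y hx hy hxy heq
    simp only [Function.comp] at heq
    rcases lt_or_gt_of_ne hxy with h | h
    · exact absurd heq (key x hx y hy h).ne
    · exact absurd heq (key y hy x hx h).ne'
  rank_mem := by
    intro e he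
    obtain ⟨x, hx, rfl⟩ := List.mem_map.1 he
    refine ⟨?_, ?_⟩
    · exact List.countP_pos_iff.2 ⟨x, hx, by simp⟩
    · simpa [normalize] using List.countP_le_length
  length_le := by
    rw [normalize, List.length_map]
    exact length_le_card t hd hn
  nonempty := by
    intro e he
    obtain ⟨x, hx, rfl⟩ := List.mem_map.1 he
    exact hn x hx

theorem IsPreSlice.without [Fintype Q] {t : RankedTuple Q} (h : IsPreSlice t) (D : Finset Q) :
    IsPreSlice (t.without D) where
  disjoint := by
    rw [RankedTuple.without, List.pairwise_map]
    exact h.disjoint.imp fun hab => hab.mono Finset.sdiff_subset Finset.sdiff_subset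
  nodup := by
    have : (t.without D).map Prod.snd = t.map Prod.snd := by simp [RankedTuple.without]
    rw [this]
    exact h.nodup
  rank_mem := by
    intro e he
    obtain ⟨x, hx, rfl⟩ := List.mem_map.1 he
    simpa [RankedTuple.without] using h.rank_mem x hx
  length_le := by
    simpa [RankedTuple.without] using h.length_le

/-- The four operations lead to a ranked slice. -/
theorem isSlice_of_grouping [Fintype Q] (A : NBA Q X) (a : X) {t : RankedTuple Q}
    (ht : IsPreSlice t) {fs : List ℕ} (hfs : fs.Perm (List.range' (t.length + 1) t.length))
    {k : ℕ} {bs : List (RankedTuple Q)} (hb : IsGrouping k (prune (step A a fs t)) bs) :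
    IsSlice (normalize (merge bs)) := by
  have hf : fs.Nodup := hfs.nodup_iff.2 List.nodup_range'
  have hdis : fs.Disjoint (t.map Prod.snd) := by
    intro y hy hy'
    have h1 := List.mem_range'_1.1 (hfs.mem_iff.1 hy)
    obtain ⟨e, he, rfl⟩ := List.mem_map.1 hy'
    have h2 := ht.rank_mem e he
    omega
  have h1 := (stepAux_disjoint A a t fs ∅).2
  have h2 := (stepAux_ranks A a t fs ∅).2 ht.nodup hf hdis
  have h3 : (prune (step A a fs t)).Pairwise (fun e e' => Disjoint e.1 e'.1) := by
    rw [← List.pairwise_map (f := Prod.fst) (R := fun S S' => Disjoint S S'), prune_sets]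
    exact (List.pairwise_map.2 h1).filter _
  have h4 : ∀ e ∈ prune (step A a fs t), e.1 ≠ ∅ := by
    intro e he
    have : e.1 ∈ (prune (step A a fs t)).map Prod.fst := List.mem_map_of_mem he
    rw [prune_sets] at this
    simpa using (List.mem_filter.1 this).2
  obtain ⟨h5, h6, h7⟩ := merge_props hb h3 (prune_nodup _ h2) h4
  exact normalize_isSlice h5 h6 h7

end RankedTuple

/-- The macrostates. The macrostates that the construction reaches from its initial macrostate are
ranked slices; after an omission of states, some of the sets may be empty. -/
def Macrostate (Q : Type*) [DecidableEq Q] [Fintype Q] : Type _ :=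
  {t : RankedTuple Q // t.IsPreSlice}

instance Macrostate.finite (Q : Type*) [DecidableEq Q] [Fintype Q] : Finite (Macrostate Q) := by
  let N := Fintype.card Q
  have h1 : Set.Finite {l : List (Finset Q × Fin (N + 1)) | l.length ≤ N} :=
    List.finite_length_le _ N
  refine Set.Finite.subset
    (h1.image (List.map (fun e : Finset Q × Fin (N + 1) => (e.1, (e.2 : ℕ))))) ?_
  intro t ht
  refine ⟨t.map (fun e => (e.1, Fin.ofNat (N + 1) e.2)), ?_, ?_⟩
  · simpa using ht.length_le
  · rw [List.map_map]
    conv_rhs => rw [← List.map_id t]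
    refine List.map_congr_left ?_
    intro e he
    have h2 := (ht.rank_mem e he).2
    have h3 := ht.length_le
    have h4 : e.2 < N + 1 := by omega
    ext1
    · rfl
    · simp [Nat.mod_eq_of_lt h4]

/-- A resolution of the freedom that the construction leaves: for every macrostate and every letter,
an assignment of the fresh ranks `n + 1, …, 2n` in `step`, and an admissible grouping in `merge`. -/
structure Resolution {Q X : Type*} [DecidableEq Q] [Fintype Q] (A : NBA Q X) where
  /-- The fresh ranks, from left to right. -/
  fresh : Macrostate Q → X → List ℕ
  fresh_perm : ∀ m a, (fresh m a).Perm (List.range' (m.1.length + 1) m.1.length)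
  /-- The intervals that are merged. -/
  group : Macrostate Q → X → List (RankedTuple Q)
  isGrouping : ∀ m a, RankedTuple.IsGrouping (m.1.step A a (fresh m a)).domRank
    (m.1.step A a (fresh m a)).prune (group m a)

namespace NBA

variable {Q X : Type*} [DecidableEq Q] [Fintype Q]

/-- The initial macrostate `(Q₀)`, with rank `1`, or the empty tuple if there is no initial state. -/
def startMacro (A : NBA Q X) : Macrostate Q :=
  if h : A.start = ∅ then ⟨[], by constructor <;> simp⟩
  else ⟨[(A.start, 1)], (RankedTuple.normalize_isSlice (t := [(A.start, 1)])
    (by simp) (by simp) (by simpa using h)).toIsPreSlice⟩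

/-- The successor macrostate. -/
def succMacro (A : NBA Q X) (σ : Resolution A) (m : Macrostate Q) (a : X) : Macrostate Q :=
  ⟨(RankedTuple.merge (σ.group m a)).normalize,
    (RankedTuple.isSlice_of_grouping A a m.2 (σ.fresh_perm m a)
      (σ.isGrouping m a)).toIsPreSlice⟩

/-- The deterministic parity automaton obtained from `A` by the unified determinization
construction. -/
def determinize (A : NBA Q X) (σ : Resolution A) : DPA (Macrostate Q) X where
  start := A.startMacro
  next := A.succMacro σ
  prio m a := (m.1.step A a (σ.fresh m a)).priority

/-- The macrostate with the states of `D` omitted. -/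
def _root_.Macrostate.without (m : Macrostate Q) (D : Finset Q) : Macrostate Q :=
  ⟨m.1.without D, m.2.without D⟩

/-- The same construction, but whenever a macrostate `m` is constructed, the states of `D m` are
omitted from it. -/
def determinizeOmitting (A : NBA Q X) (σ : Resolution A) (D : Macrostate Q → Finset Q) :
    DPA (Macrostate Q) X where
  start := A.startMacro.without (D A.startMacro)
  next m a := (A.succMacro σ m a).without (D (A.succMacro σ m a))
  prio m a := (m.1.step A a (σ.fresh m a)).priority

end NBA

/-!
Both automata recognize `A.lang A.start`. It suffices to show this for every admissible omission
function `D` and every resolution, because the unmodified construction is the one with `D = ∅`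
(`NBA.determinizeOmitting_empty`).

**Soundness** (`NBA.lang_determinizeOmitting_subset`). Assume that the rank `k` has good events
infinitely often, and that from some point on it never disappears and no smaller rank has an event.
Let `U` be the set of the states in the sets up to the set of rank `k`. What is strictly to the
right of the set of rank `k` remains strictly to its right, so all states of the next `U` are
successors of states of `U`, and König's lemma gives an infinite run inside the sets `U` in which
each state is a successor kept by `step`. If this run visits accepting states only finitely often,
then from some point on it does not meet the set of rank `k`: otherwise the nonaccepting part of
this set would stay nonempty, and rank `k` would have no further good event. Moreover, the states of
`U` strictly to the right of the run are again nonempty, and all of them are successors of such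
states. They form a smaller family of sets to which the argument applies again; as the size
decreases, some run must visit accepting states infinitely often
(`RankedTuple.RankTrace.exists_run_of_family`). Omitting states does no harm here, since all states
of a macrostate remain reachable and the positions and ranks do not change.

**Completeness** (`NBA.Admissible.lang_subset`). Call a state live if it accepts the rest of the
word, and consider the leftmost set that contains a live state. An omitted live state has a live
state further to the left, so no live state of this set is omitted
(`NBA.Admissible.notMem`). Its live successors lie in the accepting or in the nonaccepting part
created by `step`, and there again in the leftmost set with live states. Assume that from some point
on no rank below `k` has an event. Let `v` be the smallest rank `≥ k` in the segment that starts
with the leftmost live set and ends before the next set of rank `< k`, with `v = 2 |Q| + 1` if the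
segment is empty (`segMin`). Then `v` never increases
(`RankedTuple.exists_leftmost_next`). If the segment is nonempty, `v` decreases whenever `k`
disappears, because rank `v` then moves down in `normalize`. If the segment is empty, that is, the
leftmost live set has rank `< k`, then the next visit of an accepting run to `F` makes it nonempty,
because the fresh ranks are `≥ k`. Hence `k` cannot disappear infinitely often, and `k ≤ |Q|`
(`NBA.Admissible.not_leftmostLive`), so the smallest priority that occurs infinitely often is even.
-/

set_option linter.unusedSectionVars false

/-! ### Tuples and positions -/

namespace NBA

variable {Q X : Type*} [DecidableEq Q]

/-- The set of `a`-successors of the states of `P`. -/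
def post (A : NBA Q X) (a : X) (P : Finset Q) : Finset Q := P.biUnion fun p => A.next p a

theorem mem_post {A : NBA Q X} {a : X} {P : Finset Q} {q : Q} :
    q ∈ A.post a P ↔ ∃ p ∈ P, q ∈ A.next p a := by
  simp [post]

theorem post_union (A : NBA Q X) (a : X) (P P' : Finset Q) :
    A.post a (P ∪ P') = A.post a P ∪ A.post a P' := by
  ext q
  simp only [mem_post, Finset.mem_union]
  grind

end NBA

namespace RankedTuple

variable {Q X : Type*} [DecidableEq Q]

@[simp] theorem states_nil : states ([] : RankedTuple Q) = ∅ := rfl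

@[simp] theorem states_cons (e : Finset Q × ℕ) (t : RankedTuple Q) :
    states (e :: t) = e.1 ∪ states t := rfl

@[simp] theorem states_append (L M : RankedTuple Q) :
    states (L ++ M) = states L ∪ states M := by
  induction L with
  | nil => simp
  | cons e L ih => simp [ih, Finset.union_assoc]

theorem states_map_rank (t : RankedTuple Q) (g : Finset Q × ℕ → ℕ) :
    states (t.map fun e => (e.1, g e)) = states t := by
  induction t with
  | nil => rfl
  | cons e t ih => simp [ih]

theorem states_normalize (t : RankedTuple Q) : states (normalize t) = states t :=
  states_map_rank t _

theorem states_without (t : RankedTuple Q) (D : Finset Q) :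
    states (t.without D) = states t \ D := by
  ext q
  simp only [mem_states, without, List.mem_map, Finset.mem_sdiff]
  grind

theorem idx_append_lt {L M : RankedTuple Q} {q : Q} :
    idx (L ++ M) q < L.length ↔ q ∈ states L := by
  rw [idx, List.findIdx_append, mem_states]
  have h := List.findIdx_lt_length (xs := L) (p := fun e => decide (q ∈ e.1))
  simp only [decide_eq_true_eq] at h
  split_ifs with h1
  · rw [← h]
  · rw [← h]
    omega

theorem idx_lt_length {t : RankedTuple Q} {q : Q} : idx t q < t.length ↔ q ∈ states t := by
  simpa using idx_append_lt (L := t) (M := []) (q := q)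

theorem idx_without {t : RankedTuple Q} {D : Finset Q} {q : Q} (hq : q ∉ D) :
    idx (t.without D) q = idx t q := by
  simp [idx, without, List.findIdx_map, Function.comp_def, hq]

/-- A state of a tuple lies in a first set. -/
theorem exists_split {t : RankedTuple Q} {q : Q} (h : q ∈ states t) :
    ∃ L S r R, t = L ++ (S, r) :: R ∧ q ∈ S ∧ q ∉ states L := by
  induction t with
  | nil => simp at h
  | cons e t ih =>
    by_cases he : q ∈ e.1
    · exact ⟨[], e.1, e.2, t, rfl, he, by simp⟩
    · rw [states_cons, Finset.mem_union] at h
      obtain ⟨L, S, r, R, rfl, hS, hL⟩ := ih (h.resolve_left he)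
      exact ⟨e :: L, S, r, R, rfl, hS, by simp [he, hL]⟩

theorem idx_split {L R : RankedTuple Q} {S : Finset Q} {r : ℕ} {q : Q} (hS : q ∈ S)
    (hL : q ∉ states L) : idx (L ++ (S, r) :: R) q = L.length := by
  have h1 := mt (idx_append_lt (M := (S, r) :: R)).1 hL
  have h2 := (idx_append_lt (L := L ++ [(S, r)]) (M := R) (q := q)).2 (by simp [hS])
  simp only [List.append_assoc, List.singleton_append, List.length_append, List.length_singleton]
    at h2
  omega

theorem idx_split_le {L R : RankedTuple Q} {S : Finset Q} {r : ℕ} {q : Q} :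
    idx (L ++ (S, r) :: R) q ≤ L.length ↔ q ∈ states L ∪ S := by
  have h2 := idx_append_lt (L := L ++ [(S, r)]) (M := R) (q := q)
  simp only [List.append_assoc, List.singleton_append, List.length_append, List.length_singleton,
    states_append, states_cons, states_nil, Finset.union_empty] at h2
  rw [← h2]
  omega

/-! ### The operation `step` -/

theorem stepAux_cons (A : NBA Q X) (a : X) (U S : Finset Q) (f r : ℕ) (fs : List ℕ)
    (t : RankedTuple Q) :
    stepAux A a U (f :: fs) ((S, r) :: t) =
      ((A.post a S \ U) ∩ A.acc, f) :: ((A.post a S \ U) \ A.acc, r) ::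
        stepAux A a (U ∪ A.post a S) fs t := by
  simp only [stepAux, NBA.post, Finset.union_sdiff_self_eq_union]

theorem stepAux_append (A : NBA Q X) (a : X) (U : Finset Q) (fs : List ℕ) (L M : RankedTuple Q)
    (h : L.length ≤ fs.length) :
    stepAux A a U fs (L ++ M) = stepAux A a U (fs.take L.length) L ++
      stepAux A a (U ∪ A.post a (states L)) (fs.drop L.length) M := by
  induction L generalizing U fs with
  | nil => simp [stepAux, NBA.post]
  | cons e L ih =>
    obtain ⟨S, r⟩ := e
    cases fs with
    | nil => simp at h
    | cons f fs =>
      simp only [List.length_cons, Nat.add_le_add_iff_right] at h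
      simp only [List.cons_append, List.length_cons, List.take_succ_cons, List.drop_succ_cons,
        stepAux_cons, ih _ _ h, states_cons, NBA.post_union, Finset.union_assoc]

theorem states_stepAux (A : NBA Q X) (a : X) (U : Finset Q) (fs : List ℕ) (t : RankedTuple Q)
    (h : t.length ≤ fs.length) :
    states (stepAux A a U fs t) = A.post a (states t) \ U := by
  induction t generalizing U fs with
  | nil => simp [stepAux, NBA.post]
  | cons e t ih =>
    obtain ⟨S, r⟩ := e
    cases fs with
    | nil => simp at h
    | cons f fs =>
      simp only [List.length_cons, Nat.add_le_add_iff_right] at h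
      rw [stepAux_cons, states_cons, states_cons, ih _ _ h, states_cons, NBA.post_union]
      ext q
      simp only [Finset.mem_union, Finset.mem_inter, Finset.mem_sdiff]
      tauto

theorem length_stepAux (A : NBA Q X) (a : X) (U : Finset Q) (fs : List ℕ) (t : RankedTuple Q)
    (h : t.length ≤ fs.length) : (stepAux A a U fs t).length = 2 * t.length := by
  induction t generalizing U fs with
  | nil => simp [stepAux]
  | cons e t ih =>
    obtain ⟨S, r⟩ := e
    cases fs with
    | nil => simp at h
    | cons f fs =>
      simp only [List.length_cons, Nat.add_le_add_iff_right] at h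
      rw [stepAux_cons, List.length_cons, List.length_cons, ih _ _ h, List.length_cons]
      omega

theorem step_split (A : NBA Q X) (a : X) {fs : List ℕ} {L R : RankedTuple Q} {S : Finset Q} {r : ℕ}
    (h : fs.length = (L ++ (S, r) :: R).length) :
    ∃ L' f fs', step A a fs (L ++ (S, r) :: R) =
        L' ++ ((A.post a S \ A.post a (states L)) ∩ A.acc, f) ::
          ((A.post a S \ A.post a (states L)) \ A.acc, r) ::
            stepAux A a (A.post a (states L ∪ S)) fs' R ∧
      states L' = A.post a (states L) ∧ f ∈ fs ∧ fs' ⊆ fs ∧ fs'.length = R.length := by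
  rw [List.length_append, List.length_cons] at h
  have h1 : (fs.drop L.length).length = R.length + 1 := by rw [List.length_drop]; omega
  rcases h2 : fs.drop L.length with _ | ⟨f, fs'⟩
  · rw [h2] at h1; simp at h1
  · have hsub : f :: fs' ⊆ fs := h2 ▸ List.drop_subset _ _
    refine ⟨stepAux A a ∅ (fs.take L.length) L, f, fs', ?_, ?_, hsub List.mem_cons_self,
      fun x hx => hsub (List.mem_cons_of_mem _ hx), by simpa [h2] using h1⟩
    · rw [step, stepAux_append _ _ _ _ _ _ (by omega), h2, Finset.empty_union, stepAux_cons,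
        NBA.post_union]
    · rw [states_stepAux _ _ _ _ _ (by rw [List.length_take]; omega), Finset.sdiff_empty]

section Ranks

variable [Fintype Q]

theorem length_eq_of_perm {fs : List ℕ} {t : RankedTuple Q}
    (hfs : fs.Perm (List.range' (t.length + 1) t.length)) : fs.length = t.length := by
  simpa using hfs.length_eq

theorem nodup_ranks_step (A : NBA Q X) (a : X) {t : RankedTuple Q} (ht : IsPreSlice t)
    {fs : List ℕ} (hfs : fs.Perm (List.range' (t.length + 1) t.length)) :
    ((step A a fs t).map Prod.snd).Nodup := by
  refine (stepAux_ranks A a t fs ∅).2 ht.nodup (hfs.nodup_iff.2 List.nodup_range') ?_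
  intro y hy hy'
  have h1 := List.mem_range'_1.1 (hfs.mem_iff.1 hy)
  obtain ⟨e, he, rfl⟩ := List.mem_map.1 hy'
  have h2 := ht.rank_mem e he
  omega

/-- A list of `n` distinct numbers from `1, …, n` contains all of them. -/
theorem mem_of_nodup_of_length {l : List ℕ} {n : ℕ} (hl : l.Nodup) (hn : l.length = n)
    (h : ∀ x ∈ l, 1 ≤ x ∧ x ≤ n) {x : ℕ} : x ∈ l ↔ 1 ≤ x ∧ x ≤ n := by
  have h1 : l.toFinset = Finset.Icc 1 n := by
    refine Finset.eq_of_subset_of_card_le ?_ ?_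
    · intro y hy
      simpa using h y (by simpa using hy)
    · rw [List.toFinset_card_of_nodup hl, hn]; simp
  rw [← List.mem_toFinset, h1, Finset.mem_Icc]

theorem IsPreSlice.mem_ranks {t : RankedTuple Q} (ht : IsPreSlice t) {x : ℕ} :
    x ∈ t.map Prod.snd ↔ 1 ≤ x ∧ x ≤ t.length := by
  refine mem_of_nodup_of_length ht.nodup (by simp) ?_
  intro x hx
  obtain ⟨e, he, rfl⟩ := List.mem_map.1 hx
  exact ht.rank_mem e he

theorem mem_ranks_step (A : NBA Q X) (a : X) {t : RankedTuple Q} (ht : IsPreSlice t)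
    {fs : List ℕ} (hfs : fs.Perm (List.range' (t.length + 1) t.length)) {x : ℕ} :
    x ∈ (step A a fs t).map Prod.snd ↔ 1 ≤ x ∧ x ≤ 2 * t.length := by
  refine mem_of_nodup_of_length (nodup_ranks_step A a ht hfs) ?_ ?_
  · rw [List.length_map, step, length_stepAux _ _ _ _ _ (length_eq_of_perm hfs).ge]
  · intro x hx
    obtain ⟨e, he, rfl⟩ := List.mem_map.1 hx
    rcases (stepAux_ranks A a t fs ∅).1 e he with h | h
    · have := List.mem_range'_1.1 (hfs.mem_iff.1 h)
      omega
    · have := ht.mem_ranks.1 h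
      omega

end Ranks

/-! ### The operation `prune` -/

theorem prune_cons_of_ne {S : Finset Q} (hS : S ≠ ∅) (r : ℕ) (t : RankedTuple Q) :
    prune ((S, r) :: t) =
      (S, (t.takeWhile (fun e => decide (e.1 = ∅))).foldr (fun e k => min e.2 k) r) :: prune t := by
  rw [prune, if_neg hS]

theorem prune_append {L R : RankedTuple Q} {S : Finset Q} (hS : S ≠ ∅) {r : ℕ} :
    prune (L ++ (S, r) :: R) = prune L ++ prune ((S, r) :: R) := by
  induction L with
  | nil => simp [prune]
  | cons e L ih =>
    obtain ⟨T, x⟩ := e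
    by_cases hT : T = ∅
    · simp [prune, hT, ih]
    · rw [List.cons_append, prune_cons_of_ne hT, prune_cons_of_ne hT, ih, List.cons_append]
      congr 3
      clear ih
      induction L with
      | nil => simp [hS]
      | cons e L ih =>
        by_cases he : e.1 = ∅
        · simp [he, ih]
        · simp [he]

theorem states_prune (t : RankedTuple Q) : states (prune t) = states t := by
  induction t with
  | nil => rfl
  | cons e t ih =>
    obtain ⟨S, r⟩ := e
    by_cases h : S = ∅ <;> simp [prune, h, ih]

theorem prune_append_of_empty {E R : RankedTuple Q} (hE : ∀ e ∈ E, e.1 = ∅) :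
    prune (E ++ R) = prune R := by
  induction E with
  | nil => rfl
  | cons e E ih =>
    obtain ⟨S, r⟩ := e
    have : S = ∅ := hE (S, r) List.mem_cons_self
    rw [List.cons_append, prune, if_pos this, ih fun e he => hE e (List.mem_cons_of_mem _ he)]

/-- Every tuple ends with a last nonempty set and some empty sets, or has only empty sets. -/
theorem exists_last_nonempty (t : RankedTuple Q) :
    (∀ e ∈ t, e.1 = ∅) ∨
      ∃ L Y y E, t = L ++ (Y, y) :: E ∧ Y ≠ ∅ ∧ ∀ e ∈ E, e.1 = ∅ := by
  induction t with
  | nil => simp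
  | cons e t ih =>
    rcases ih with h | ⟨L, Y, y, E, rfl, hY, hE⟩
    · by_cases he : e.1 = ∅
      · left
        simpa [he] using h
      · exact Or.inr ⟨[], e.1, e.2, t, rfl, he, h⟩
    · exact Or.inr ⟨e :: L, Y, y, E, rfl, hY, hE⟩

/-- A rank that does not disappear in `prune` stays at its set if that set is nonempty, and
otherwise moves to the left past empty sets only. -/
theorem prune_split_rank {L R : RankedTuple Q} {S : Finset Q} {k : ℕ}
    (hnd : ((L ++ (S, k) :: R).map Prod.snd).Nodup)
    (hk : k ∈ (prune (L ++ (S, k) :: R)).map Prod.snd) :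
    ∃ L' Y, prune (L ++ (S, k) :: R) = L' ++ (Y, k) :: prune R ∧ Y ≠ ∅ ∧ S ⊆ Y := by
  rw [List.map_append, List.map_cons, List.nodup_append', List.nodup_cons] at hnd
  obtain ⟨-, ⟨hkR, -⟩, hdis⟩ := hnd
  have hkL : k ∉ L.map Prod.snd := fun h => hdis h List.mem_cons_self
  have hkR' : k ∉ (prune R).map Prod.snd := fun h => hkR (prune_ranks_subset R k h)
  by_cases hS : S = ∅
  · subst hS
    rcases exists_last_nonempty L with hL | ⟨L, Y, y, E, rfl, hY, hE⟩
    · rw [prune_append_of_empty hL, prune, if_pos rfl] at hk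
      exact absurd hk hkR'
    · have h1 : prune (E ++ (∅, k) :: R) = prune R := by
        rw [prune_append_of_empty hE, prune, if_pos rfl]
      rw [List.append_assoc, List.cons_append, prune_append hY, prune_cons_of_ne hY, h1] at hk ⊢
      rw [List.map_append, List.map_cons, List.mem_append, List.mem_cons] at hk
      rcases hk with hk | hk | hk
      · refine absurd ?_ hkL
        rw [List.map_append, List.mem_append]
        exact Or.inl (prune_ranks_subset L k hk)
      · exact ⟨prune L, Y, congrArg (fun z => prune L ++ (Y, z) :: prune R) hk.symm, hY,
          Finset.empty_subset _⟩
      · exact absurd hk hkR'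
  · rw [prune_append hS, prune_cons_of_ne hS] at hk ⊢
    rw [List.map_append, List.map_cons, List.mem_append, List.mem_cons] at hk
    rcases hk with hk | hk | hk
    · exact absurd (prune_ranks_subset L k hk) hkL
    · exact ⟨prune L, S, congrArg (fun z => prune L ++ (S, z) :: prune R) hk.symm, hS, subset_rfl⟩
    · exact absurd hk hkR'

/-! ### Events -/

theorem mem_bad {t : RankedTuple Q} {k : ℕ} :
    k ∈ bad t ↔ k ∈ t.map Prod.snd ∧ k ∉ (prune t).map Prod.snd := by
  simp [bad, ranks]

theorem mem_good {t : RankedTuple Q} {k : ℕ} :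
    k ∈ good t ↔ k ∈ (prune t).map Prod.snd ∧ (∅, k) ∈ t := by
  simp [good, ranks]

theorem notMem_bad_of_mem_good {t : RankedTuple Q} {k : ℕ} (h : k ∈ good t) : k ∉ bad t :=
  fun h' => (mem_bad.1 h').2 (mem_good.1 h).1

section DomRank

variable [Fintype Q]

theorem domRank_le {t : RankedTuple Q} {k : ℕ} (h : k ∈ good t ∪ bad t) : domRank t ≤ k := by
  obtain ⟨m, hm⟩ := Finset.min_of_mem h
  rw [domRank, hm]
  exact Finset.min_le_of_eq h hm

theorem domRank_mem (t : RankedTuple Q) :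
    domRank t ∈ good t ∪ bad t ∨ domRank t = Fintype.card Q + 1 := by
  rcases (good t ∪ bad t).eq_empty_or_nonempty with h | h
  · right
    rw [domRank, h]
    rfl
  · left
    obtain ⟨m, hm⟩ := Finset.min_of_nonempty h
    rw [domRank, hm]
    exact Finset.mem_of_min hm

/-- An empty set has an event, so its rank is not below the dominating rank. -/
theorem domRank_le_of_empty {t : RankedTuple Q} {k : ℕ} (h : (∅, k) ∈ t) : domRank t ≤ k := by
  refine domRank_le ?_
  rw [Finset.mem_union, mem_good, mem_bad]
  have : k ∈ t.map Prod.snd := List.mem_map.2 ⟨_, h, rfl⟩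
  tauto

theorem mem_ranks_prune_of_lt {t : RankedTuple Q} {k : ℕ} (hk : k ∈ t.map Prod.snd)
    (h : k < domRank t) : k ∈ (prune t).map Prod.snd := by
  by_contra h'
  have := domRank_le (Finset.mem_union_right (good t) (mem_bad.2 ⟨hk, h'⟩))
  omega

end DomRank

/-! ### The operation `merge` -/

theorem states_merge (bs : List (RankedTuple Q)) : states (merge bs) = states bs.flatten := by
  induction bs with
  | nil => rfl
  | cons b bs ih =>
    rw [List.flatten_cons, states_append, ← ih]
    rfl

theorem flatten_split {α : Type*} {bs : List (List α)} {L R : List α} {x : α}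
    (h : bs.flatten = L ++ x :: R) :
    ∃ bs₁ b₁ b₂ bs₂, bs = bs₁ ++ (b₁ ++ x :: b₂) :: bs₂ ∧ L = bs₁.flatten ++ b₁ ∧
      R = b₂ ++ bs₂.flatten := by
  induction bs generalizing L with
  | nil => simp at h
  | cons b bs ih =>
    rw [List.flatten_cons, List.append_eq_append_iff] at h
    rcases h with ⟨M, rfl, h⟩ | ⟨M, rfl, h⟩
    · obtain ⟨bs₁, b₁, b₂, bs₂, rfl, rfl, rfl⟩ := ih h
      exact ⟨b :: bs₁, b₁, b₂, bs₂, rfl, by simp, rfl⟩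
    · cases M with
      | nil =>
        obtain ⟨bs₁, b₁, b₂, bs₂, h1, h2, h3⟩ := ih (L := []) (by simpa using h.symm)
        exact ⟨(L ++ []) :: bs₁, b₁, b₂, bs₂, by simp [h1], by simp [List.append_assoc, ← h2], h3⟩
      | cons y M =>
        rw [List.cons_append, List.cons.injEq] at h
        obtain ⟨rfl, rfl⟩ := h
        exact ⟨[], L, M, bs, rfl, rfl, rfl⟩

/-- The smallest rank of an interval. -/
def minRank (b : RankedTuple Q) : ℕ := (b.map Prod.snd).min?.getD 0

theorem merge_append_cons (bs₁ bs₂ : List (RankedTuple Q)) (b : RankedTuple Q) :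
    merge (bs₁ ++ b :: bs₂) = merge bs₁ ++ (states b, minRank b) :: merge bs₂ := by
  simp [merge, minRank]

theorem minRank_le {b : RankedTuple Q} {e : Finset Q × ℕ} (he : e ∈ b) : minRank b ≤ e.2 := by
  have h1 : e.2 ∈ b.map Prod.snd := List.mem_map_of_mem he
  rcases h : (b.map Prod.snd).min? with _ | k
  · rw [List.min?_eq_none_iff] at h
    rw [h] at h1
    simp at h1
  · rw [minRank, h]
    exact (List.min?_eq_some_iff.1 h).2 _ h1

theorem minRank_mem {b : RankedTuple Q} (hb : b ≠ []) : minRank b ∈ b.map Prod.snd :=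
  merge_rank_mem hb

theorem IsGrouping.rank_le_of_mem {k : ℕ} {t : RankedTuple Q} {bs : List (RankedTuple Q)}
    (h : IsGrouping k t bs) {b : RankedTuple Q} (hb : b ∈ bs) :
    b.length = 1 ∨ ∀ e ∈ b, k ≤ e.2 := by
  obtain ⟨hne, h1 | ⟨h1, h2⟩⟩ := h.2 b hb
  · exact Or.inl h1
  · right
    intro e he
    rw [← List.dropLast_append_getLast hne, List.mem_append, List.mem_singleton] at he
    rcases he with he | rfl
    · exact (h1 e he).le
    · exact h2 _ (by simp [List.getLast?_eq_getLast_of_ne_nil hne])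

/-- A set whose rank is at most the dominating rank is merged only with sets on its left, and
passes on its rank. -/
theorem IsGrouping.eq_nil_of_rank_le {d k : ℕ} {t : RankedTuple Q} {bs : List (RankedTuple Q)}
    (h : IsGrouping d t bs) (hk : k ≤ d) {b₁ b₂ : RankedTuple Q} {Y : Finset Q}
    (hb : b₁ ++ (Y, k) :: b₂ ∈ bs) :
    b₂ = [] ∧ minRank (b₁ ++ (Y, k) :: b₂) = k := by
  obtain ⟨hne, h1 | ⟨h1, h2⟩⟩ := h.2 _ hb
  · rw [List.length_append, List.length_cons] at h1
    have e1 : b₁ = [] := List.eq_nil_of_length_eq_zero (by omega)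
    have e2 : b₂ = [] := List.eq_nil_of_length_eq_zero (by omega)
    subst e1 e2
    simp [minRank]
  · rcases List.eq_nil_or_concat b₂ with rfl | ⟨b₃, z, rfl⟩
    · refine ⟨rfl, le_antisymm (minRank_le (e := (Y, k)) (by simp)) ?_⟩
      obtain ⟨e, he, hee⟩ := List.mem_map.1 (minRank_mem hne)
      rw [← hee]
      rw [List.mem_append, List.mem_singleton] at he
      rcases he with he | rfl
      · have := h1 e (by simpa using he)
        omega
      · exact le_rfl
    · have := h1 (Y, k) (by
        rw [List.concat_eq_append, ← List.cons_append, ← List.append_assoc, List.dropLast_concat]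
        simp)
      simp only at this
      omega

theorem IsGrouping.mem_ranks_merge {d k : ℕ} {t : RankedTuple Q} {bs : List (RankedTuple Q)}
    (h : IsGrouping d t bs) (hk : k ≤ d) (hkt : k ∈ t.map Prod.snd) :
    k ∈ (merge bs).map Prod.snd := by
  obtain ⟨e, he, rfl⟩ := List.mem_map.1 hkt
  obtain ⟨L, R, rfl⟩ := List.append_of_mem he
  obtain ⟨bs₁, b₁, b₂, bs₂, rfl, -, -⟩ := flatten_split h.1
  obtain ⟨-, h2⟩ := h.eq_nil_of_rank_le hk (b₁ := b₁) (b₂ := b₂) (Y := e.1) (by simp)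
  rw [merge_append_cons, h2]
  simp

theorem IsGrouping.ranks_merge_subset {d : ℕ} {t : RankedTuple Q} {bs : List (RankedTuple Q)}
    (h : IsGrouping d t bs) {x : ℕ} (hx : x ∈ (merge bs).map Prod.snd) : x ∈ t.map Prod.snd := by
  obtain ⟨e, he, rfl⟩ := List.mem_map.1 hx
  obtain ⟨b, hb, rfl⟩ := List.mem_map.1 he
  obtain ⟨y, hy, hyx⟩ := List.mem_map.1 (minRank_mem (h.2 b hb).1)
  rw [← h.1]
  exact List.mem_map.2 ⟨y, List.mem_flatten.2 ⟨b, hb, hy⟩, hyx⟩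

/-! ### The operation `normalize` -/

/-- The new rank of the sets of rank `x` in `normalize t`. -/
def newRank (t : RankedTuple Q) (x : ℕ) : ℕ := t.countP fun e => decide (e.2 ≤ x)

theorem normalize_eq (t : RankedTuple Q) :
    normalize t = t.map fun e => (e.1, newRank t e.2) := rfl

theorem newRank_eq_card {t : RankedTuple Q} (ht : (t.map Prod.snd).Nodup) (x : ℕ) :
    newRank t x = (t.ranks.filter (· ≤ x)).card := by
  have h : newRank t x = ((t.map Prod.snd).filter (fun y => decide (y ≤ x))).length := by
    rw [newRank, ← List.countP_eq_length_filter, List.countP_map]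
    rfl
  rw [h, ← List.toFinset_card_of_nodup (ht.filter _), List.toFinset_filter, ranks]
  simp

theorem newRank_le {t : RankedTuple Q} (ht : (t.map Prod.snd).Nodup)
    (h1 : ∀ x ∈ t.map Prod.snd, 1 ≤ x) (x : ℕ) : newRank t x ≤ x := by
  rw [newRank_eq_card ht]
  refine (Finset.card_le_card (t := Finset.Icc 1 x) ?_).trans (by simp)
  intro y hy
  rw [Finset.mem_filter, ranks, List.mem_toFinset] at hy
  exact Finset.mem_Icc.2 ⟨h1 y hy.1, hy.2⟩

theorem newRank_lt {t : RankedTuple Q} (ht : (t.map Prod.snd).Nodup)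
    (h1 : ∀ x ∈ t.map Prod.snd, 1 ≤ x) {k x : ℕ} (hk : k ∉ t.map Prod.snd) (hk1 : 1 ≤ k)
    (hkx : k ≤ x) : newRank t x < x := by
  rw [newRank_eq_card ht]
  have : (t.ranks.filter (· ≤ x)).card < (Finset.Icc 1 x).card := by
    refine Finset.card_lt_card (Finset.ssubset_iff_of_subset ?_ |>.2 ⟨k, ?_, ?_⟩)
    · intro y hy
      rw [Finset.mem_filter, ranks, List.mem_toFinset] at hy
      exact Finset.mem_Icc.2 ⟨h1 y hy.1, hy.2⟩
    · exact Finset.mem_Icc.2 ⟨hk1, hkx⟩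
    · rw [Finset.mem_filter, ranks, List.mem_toFinset]
      exact fun h => hk h.1
  simpa using this

theorem le_newRank {t : RankedTuple Q} (ht : (t.map Prod.snd).Nodup) {k x : ℕ}
    (h : ∀ y, 1 ≤ y → y < k → y ∈ t.map Prod.snd) (hx : x ∈ t.map Prod.snd) (hkx : k ≤ x) :
    k ≤ newRank t x := by
  rw [newRank_eq_card ht]
  calc k ≤ (insert x (Finset.Ico 1 k)).card := by
        rw [Finset.card_insert_of_notMem (by simp only [Finset.mem_Ico]; omega), Nat.card_Ico]
        omega
    _ ≤ _ := Finset.card_le_card ?_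
  intro y hy
  rw [Finset.mem_insert, Finset.mem_Ico] at hy
  rw [Finset.mem_filter, ranks, List.mem_toFinset]
  rcases hy with rfl | hy
  · exact ⟨hx, le_rfl⟩
  · exact ⟨h y hy.1 hy.2, by omega⟩

end RankedTuple

namespace RankedTuple

variable {Q X : Type*} [DecidableEq Q]

/-! ### One transition of the construction -/

theorem disjoint_states {L M : RankedTuple Q}
    (h : (L ++ M).Pairwise fun e e' => Disjoint e.1 e'.1) : Disjoint (states L) (states M) := by
  rw [Finset.disjoint_left]
  intro q hq hq'
  obtain ⟨e, he, hqe⟩ := mem_states.1 hq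
  obtain ⟨e', he', hqe'⟩ := mem_states.1 hq'
  exact Finset.disjoint_left.1 ((List.pairwise_append.1 h).2.2 e he e' he') hqe hqe'

/-- The (zero-based) position of the set of rank `k`. -/
def rankIdx (t : RankedTuple Q) (k : ℕ) : ℕ := t.findIdx fun e => decide (e.2 = k)

theorem rankIdx_split {L R : RankedTuple Q} {S : Finset Q} {k : ℕ}
    (h : ((L ++ (S, k) :: R).map Prod.snd).Nodup) :
    rankIdx (L ++ (S, k) :: R) k = L.length := by
  have hL : ∀ e ∈ L, e.2 ≠ k := by
    intro e he hek
    rw [List.map_append, List.map_cons, List.nodup_append'] at h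
    exact h.2.2 (List.mem_map_of_mem he) (hek ▸ List.mem_cons_self)
  rw [rankIdx, List.findIdx_append, if_neg]
  · rw [List.findIdx_cons]
    simp
  · rw [List.findIdx_lt_length]
    rintro ⟨e, he, hek⟩
    exact hL e he (by simpa using hek)

theorem rankIdx_without (t : RankedTuple Q) (D : Finset Q) (k : ℕ) :
    rankIdx (t.without D) k = rankIdx t k := by
  simp [rankIdx, without, List.findIdx_map, Function.comp_def]

/-- `q'` is an `a`-successor of `q`, and of no state in a set further left. These are the
successors that `step` keeps in the set obtained from the set of `q`. -/
def SliceSucc (A : NBA Q X) (a : X) (t : RankedTuple Q) (q q' : Q) : Prop :=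
  q ∈ states t ∧ q' ∈ A.next q a ∧ ∀ p ∈ states t, q' ∈ A.next p a → idx t q ≤ idx t p

/-- The states in the sets up to and including the set of rank `k`. -/
def upto (t : RankedTuple Q) (k : ℕ) : Finset Q :=
  (states t).filter fun q => idx t q ≤ rankIdx t k

theorem mem_upto {t : RankedTuple Q} {k : ℕ} {q : Q} :
    q ∈ upto t k ↔ q ∈ states t ∧ idx t q ≤ rankIdx t k := Finset.mem_filter

theorem mem_upto_without {t : RankedTuple Q} {D : Finset Q} {k : ℕ} {q : Q} :
    q ∈ upto (t.without D) k ↔ q ∈ upto t k ∧ q ∉ D := by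
  rw [mem_upto, mem_upto, states_without, rankIdx_without, Finset.mem_sdiff]
  constructor
  · rintro ⟨⟨h1, h2⟩, h3⟩
    rw [idx_without h2] at h3
    exact ⟨⟨h1, h3⟩, h2⟩
  · rintro ⟨⟨h1, h3⟩, h2⟩
    rw [idx_without h2]
    exact ⟨⟨h1, h2⟩, h3⟩

theorem upto_split {L R : RankedTuple Q} {S : Finset Q} {k : ℕ}
    (h : ((L ++ (S, k) :: R).map Prod.snd).Nodup) :
    upto (L ++ (S, k) :: R) k = states L ∪ S := by
  ext q
  rw [mem_upto, rankIdx_split h, idx_split_le, states_append, states_cons]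
  simp only [Finset.mem_union]
  tauto

theorem exists_sliceSucc_of_mem_post_upto {A : NBA Q X} {a : X} {t : RankedTuple Q} {q' : Q}
    {k : ℕ} (h : q' ∈ A.post a (upto t k)) :
    ∃ q ∈ upto t k, SliceSucc A a t q q' := by
  obtain ⟨p, hp, hpq⟩ := NBA.mem_post.1 h
  obtain ⟨q, hq, hmin⟩ := Finset.exists_min_image ((states t).filter fun p => q' ∈ A.next p a)
    (idx t) ⟨p, Finset.mem_filter.2 ⟨(mem_upto.1 hp).1, hpq⟩⟩
  rw [Finset.mem_filter] at hq
  have hmin' : ∀ p ∈ states t, q' ∈ A.next p a → idx t q ≤ idx t p :=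
    fun p h1 h2 => hmin p (Finset.mem_filter.2 ⟨h1, h2⟩)
  exact ⟨q, mem_upto.2 ⟨hq.1, (hmin' p (mem_upto.1 hp).1 hpq).trans (mem_upto.1 hp).2⟩,
    hq.1, hq.2, hmin'⟩

variable [Fintype Q]

/-- A nonempty set after `step` lies in one set of the successor, and all sets on its left (right)
end up in this set or further left (right). -/
theorem exists_split_normalize_merge {d : ℕ} {L R : RankedTuple Q} {S : Finset Q} {r : ℕ}
    {bs : List (RankedTuple Q)} (hS : S ≠ ∅) (hb : IsGrouping d (prune (L ++ (S, r) :: R)) bs) :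
    ∃ L' Y y R', normalize (merge bs) = L' ++ (Y, y) :: R' ∧ S ⊆ Y ∧
      states L' ⊆ states L ∧ states R' ⊆ states R := by
  have h := hb.1
  rw [prune_append hS, prune_cons_of_ne hS] at h
  obtain ⟨bs₁, b₁, b₂, bs₂, rfl, h1, h2⟩ := flatten_split h
  have h1' := congrArg states h1
  have h2' := congrArg states h2
  rw [states_prune, states_append] at h1' h2'
  rw [normalize_eq]
  generalize newRank (merge (bs₁ ++ (b₁ ++ _ :: b₂) :: bs₂)) = g
  rw [merge_append_cons, List.map_append, List.map_cons]
  refine ⟨_, _, _, _, rfl, ?_, ?_, ?_⟩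
  · simp only [states_append, states_cons]
    exact Finset.subset_union_left.trans Finset.subset_union_right
  · rw [states_map_rank, states_merge, h1']
    exact Finset.subset_union_left
  · rw [states_map_rank, states_merge, h2']
    exact Finset.subset_union_right

variable {A : NBA Q X} {a : X} {t : RankedTuple Q} {fs : List ℕ} {bs : List (RankedTuple Q)}

theorem states_next (hfs : fs.Perm (List.range' (t.length + 1) t.length))
    {d : ℕ} (hb : IsGrouping d (prune (step A a fs t)) bs) :
    states (normalize (merge bs)) = A.post a (states t) := by
  rw [states_normalize, states_merge, hb.1, states_prune, step,
    states_stepAux _ _ _ _ _ (length_eq_of_perm hfs).ge, Finset.sdiff_empty]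

theorem nodup_ranks_merge (ht : IsPreSlice t)
    (hfs : fs.Perm (List.range' (t.length + 1) t.length))
    {d : ℕ} (hb : IsGrouping d (prune (step A a fs t)) bs) :
    ((merge bs).map Prod.snd).Nodup := by
  have h := prune_nodup _ (nodup_ranks_step A a ht hfs)
  rw [← hb.1, List.map_flatten, List.nodup_flatten, List.pairwise_map] at h
  rw [merge, List.map_map, List.Nodup, List.pairwise_map]
  refine h.2.imp_of_mem ?_
  intro b b' hbm hbm' hbb heq
  refine hbb (minRank_mem (hb.2 b hbm).1) ?_
  have heq' : minRank b = minRank b' := heq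
  rw [heq']
  exact minRank_mem (hb.2 b' hbm').1

theorem mem_ranks_step_of_mem_ranks_merge
    {d : ℕ} (hb : IsGrouping d (prune (step A a fs t)) bs) {x : ℕ}
    (hx : x ∈ (merge bs).map Prod.snd) : x ∈ (step A a fs t).map Prod.snd :=
  prune_ranks_subset _ _ (hb.ranks_merge_subset hx)

/-- The ranks up to `k` survive a transition if `k` does not disappear and no smaller rank has an
event. -/
theorem mem_ranks_merge_of_le (ht : IsPreSlice t)
    (hfs : fs.Perm (List.range' (t.length + 1) t.length))
    (hb : IsGrouping (domRank (step A a fs t)) (prune (step A a fs t)) bs) {k : ℕ}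
    (hk : k ≤ domRank (step A a fs t)) (hbad : k ∉ bad (step A a fs t)) (hkt : k ≤ 2 * t.length)
    {y : ℕ} (hy : 1 ≤ y) (hyk : y ≤ k) : y ∈ (merge bs).map Prod.snd := by
  have h1 : y ∈ (step A a fs t).map Prod.snd :=
    (mem_ranks_step A a ht hfs).2 ⟨hy, hyk.trans hkt⟩
  refine hb.mem_ranks_merge (hyk.trans hk) ?_
  rcases hyk.eq_or_lt with rfl | hlt
  · by_contra h2
    exact hbad (mem_bad.2 ⟨h1, h2⟩)
  · exact mem_ranks_prune_of_lt h1 (hlt.trans_le hk)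

theorem le_length_next (ht : IsPreSlice t)
    (hfs : fs.Perm (List.range' (t.length + 1) t.length))
    (hb : IsGrouping (domRank (step A a fs t)) (prune (step A a fs t)) bs) {k : ℕ}
    (hk : k ≤ domRank (step A a fs t)) (hbad : k ∉ bad (step A a fs t)) (hkt : k ≤ 2 * t.length) :
    k ≤ (normalize (merge bs)).length := by
  have h : Finset.Icc 1 k ⊆ ((merge bs).map Prod.snd).toFinset := by
    intro y hy
    rw [Finset.mem_Icc] at hy
    rw [List.mem_toFinset]
    exact mem_ranks_merge_of_le ht hfs hb hk hbad hkt hy.1 hy.2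
  have h2 := (Finset.card_le_card h).trans (List.toFinset_card_le _)
  simpa [normalize] using h2

/-! ### Transitions in which a rank persists -/

theorem newRank_eq_self (ht : IsPreSlice t)
    (hfs : fs.Perm (List.range' (t.length + 1) t.length))
    (hb : IsGrouping (domRank (step A a fs t)) (prune (step A a fs t)) bs) {k : ℕ}
    (hk1 : 1 ≤ k) (hk : k ≤ domRank (step A a fs t)) (hbad : k ∉ bad (step A a fs t))
    (hkt : k ≤ 2 * t.length) :
    newRank (merge bs) k = k :=
  le_antisymm
    (newRank_le (nodup_ranks_merge ht hfs hb)
      (fun _ hx => ((mem_ranks_step A a ht hfs).1 (mem_ranks_step_of_mem_ranks_merge hb hx)).1) k)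
    (le_newRank (nodup_ranks_merge ht hfs hb)
      (fun _ hy hyk => mem_ranks_merge_of_le ht hfs hb hk hbad hkt hy hyk.le)
      (mem_ranks_merge_of_le ht hfs hb hk hbad hkt hk1 le_rfl) le_rfl)

/-- The set of rank `k` in the successor, if `k` does not disappear and no smaller rank has an
event: everything strictly to the right of the old set of rank `k` stays strictly to the right. -/
theorem exists_split_of_rank (ht : IsPreSlice t)
    (hfs : fs.Perm (List.range' (t.length + 1) t.length))
    (hb : IsGrouping (domRank (step A a fs t)) (prune (step A a fs t)) bs) {k : ℕ}
    (hk1 : 1 ≤ k) (hkt : k ≤ t.length)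
    (hk : k ≤ domRank (step A a fs t)) (hbad : k ∉ bad (step A a fs t)) :
    ∃ L S R L' Y R', t = L ++ (S, k) :: R ∧ normalize (merge bs) = L' ++ (Y, k) :: R' ∧ Y ≠ ∅ ∧
      (A.post a S \ A.post a (states L)) \ A.acc ⊆ Y ∧
      states R' = A.post a (states R) \ A.post a (states L ∪ S) ∧
      (k ∈ good (step A a fs t) → (A.post a S \ A.post a (states L)) \ A.acc = ∅) := by
  obtain ⟨⟨S, x⟩, he, hxk⟩ := List.mem_map.1 (ht.mem_ranks.2 ⟨hk1, hkt⟩)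
  simp only at hxk
  subst hxk
  obtain ⟨L, R, rfl⟩ := List.append_of_mem he
  have hnorm := newRank_eq_self ht hfs hb hk1 hk hbad (by omega)
  obtain ⟨L₁, f, fs', hs, -, -, -, hlen⟩ := step_split A a (length_eq_of_perm hfs)
  have hnd := nodup_ranks_step A a ht hfs
  have hmem : x ∈ (step A a fs (L ++ (S, x) :: R)).map Prod.snd :=
    (mem_ranks_step A a ht hfs).2 (by omega)
  have hpr : x ∈ (prune (step A a fs (L ++ (S, x) :: R))).map Prod.snd := by
    by_contra h
    exact hbad (mem_bad.2 ⟨hmem, h⟩)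
  have hgood : x ∈ good (step A a fs (L ++ (S, x) :: R)) →
      (A.post a S \ A.post a (states L)) \ A.acc = ∅ := by
    intro hg
    have h1 := (mem_good.1 hg).2
    have h2 : ((A.post a S \ A.post a (states L)) \ A.acc, x) ∈
        step A a fs (L ++ (S, x) :: R) := by rw [hs]; simp
    have h3 := List.inj_on_of_nodup_map hnd h1 h2 rfl
    exact (congrArg Prod.fst h3).symm
  rw [List.append_cons L₁] at hs
  rw [hs] at hnd hpr
  obtain ⟨L₂, Y, hprune, hY, hSY⟩ := prune_split_rank hnd hpr
  have hflat := hb.1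
  rw [hs, hprune] at hflat
  obtain ⟨bs₁, b₁, b₂, bs₂, rfl, h1, h2⟩ := flatten_split hflat
  obtain ⟨rfl, hmin⟩ := hb.eq_nil_of_rank_le hk (b₁ := b₁) (b₂ := b₂) (Y := Y) (by simp)
  rw [normalize_eq]
  revert hnorm
  generalize newRank (merge (bs₁ ++ (b₁ ++ (Y, x) :: []) :: bs₂)) = g
  intro hnorm
  rw [merge_append_cons, List.map_append, List.map_cons, hmin, hnorm]
  refine ⟨L, S, R, _, _, _, rfl, rfl, ?_, ?_, ?_, hgood⟩
  · obtain ⟨q, hq⟩ := Finset.nonempty_iff_ne_empty.2 hY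
    exact Finset.nonempty_iff_ne_empty.1 ⟨q, by simp [hq]⟩
  · refine hSY.trans ?_
    simp only [states_append, states_cons]
    exact Finset.subset_union_left.trans Finset.subset_union_right
  · rw [states_map_rank, states_merge, ← List.nil_append (List.flatten _), ← h2, states_prune,
      states_stepAux _ _ _ _ _ hlen.ge]

/-- A nonaccepting successor of a state stays weakly to the right of all successors of states
weakly further left. -/
theorem idx_le_of_sliceSucc (ht : IsPreSlice t)
    (hfs : fs.Perm (List.range' (t.length + 1) t.length))
    (hb : IsGrouping (domRank (step A a fs t)) (prune (step A a fs t)) bs) {q q' p p' : Q}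
    (hq : SliceSucc A a t q q') (hq' : q' ∉ A.acc) (hp : p ∈ states t) (hpp : p' ∈ A.next p a)
    (hle : idx t p ≤ idx t q) :
    idx (normalize (merge bs)) p' ≤ idx (normalize (merge bs)) q' := by
  have hstates := states_next hfs hb
  have hslice := isSlice_of_grouping A a ht hfs hb
  obtain ⟨hqt, hqq, hmin⟩ := hq
  obtain ⟨L, S, r, R, rfl, hqS, hqL⟩ := exists_split hqt
  rw [idx_split hqS hqL] at hle hmin
  have hpost : q' ∉ A.post a (states L) := by
    intro h
    obtain ⟨x, hx, hxq⟩ := NBA.mem_post.1 h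
    have h1 := hmin x (by simp [hx]) hxq
    have h2 := (idx_append_lt (M := (S, r) :: R)).2 hx
    omega
  obtain ⟨L₁, f, fs', hs, hL₁, -, -, hlen⟩ := step_split A a (length_eq_of_perm hfs)
  rw [List.append_cons L₁] at hs
  have hq2 : q' ∈ (A.post a S \ A.post a (states L)) \ A.acc := by
    simp only [Finset.mem_sdiff]
    exact ⟨⟨NBA.mem_post.2 ⟨q, hqS, hqq⟩, hpost⟩, hq'⟩
  rw [hs] at hb
  obtain ⟨L', Y, y, R', hm, hSY, hL', hR'⟩ :=
    exists_split_normalize_merge (Finset.ne_empty_of_mem hq2) hb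
  have hqL' : q' ∉ states L' := by
    intro h
    have h1 := hL' h
    rw [states_append, hL₁, states_cons, states_nil, Finset.union_empty, Finset.mem_union,
      Finset.mem_inter] at h1
    tauto
  have hpR' : p' ∉ states R' := by
    intro h
    have h1 := hR' h
    rw [states_stepAux _ _ _ _ _ hlen.ge, Finset.mem_sdiff] at h1
    exact h1.2 (NBA.mem_post.2 ⟨p, idx_split_le.1 hle, hpp⟩)
  have hpm : p' ∈ states (normalize (merge bs)) := by
    rw [hstates]
    exact NBA.mem_post.2 ⟨p, hp, hpp⟩
  rw [hm, idx_split (hSY hq2) hqL', idx_split_le]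
  rw [hm, states_append, states_cons] at hpm
  simp only [Finset.mem_union] at hpm ⊢
  tauto

section Persist

variable (ht : IsPreSlice t) (hfs : fs.Perm (List.range' (t.length + 1) t.length))
    (hb : IsGrouping (domRank (step A a fs t)) (prune (step A a fs t)) bs) {k : ℕ}
    (hk1 : 1 ≤ k) (hkt : k ≤ t.length)
    (hk : k ≤ domRank (step A a fs t)) (hbad : k ∉ bad (step A a fs t))

include ht hfs hb hk1 hkt hk hbad

theorem upto_next_subset : upto (normalize (merge bs)) k ⊆ A.post a (upto t k) := by
  have hstates := states_next hfs hb
  have hslice := isSlice_of_grouping A a ht hfs hb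
  obtain ⟨L, S, R, L', Y, R', rfl, hm, -, -, hR', -⟩ :=
    exists_split_of_rank ht hfs hb hk1 hkt hk hbad
  rw [hm] at hstates hslice ⊢
  rw [upto_split ht.nodup, upto_split hslice.nodup]
  intro q hq
  have h1 : q ∈ A.post a (states (L ++ (S, k) :: R)) := by
    rw [← hstates]
    simp only [states_append, states_cons, Finset.mem_union] at hq ⊢
    tauto
  by_contra h2
  rw [states_append, states_cons, ← Finset.union_assoc, NBA.post_union, Finset.mem_union] at h1
  have h3 : q ∈ states R' := by
    rw [hR', Finset.mem_sdiff]
    tauto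
  have h4 : ((L' ++ [(Y, k)]) ++ R').Pairwise fun e e' => Disjoint e.1 e'.1 := by
    simpa using hslice.disjoint
  exact Finset.disjoint_left.1 (disjoint_states h4) (by simpa using hq) h3

theorem exists_idx_eq_rankIdx : ∃ q ∈ states (normalize (merge bs)),
    idx (normalize (merge bs)) q = rankIdx (normalize (merge bs)) k := by
  have hslice := isSlice_of_grouping A a ht hfs hb
  obtain ⟨L, S, R, L', Y, R', rfl, hm, hY, -, -, -⟩ :=
    exists_split_of_rank ht hfs hb hk1 hkt hk hbad
  rw [hm] at hslice ⊢
  rw [rankIdx_split hslice.nodup]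
  obtain ⟨q, hq⟩ := Finset.nonempty_iff_ne_empty.2 hY
  refine ⟨q, by simp [hq], idx_split hq ?_⟩
  exact fun h => Finset.disjoint_left.1 (disjoint_states hslice.disjoint) h (by simp [hq])

/-- Nonaccepting successors of the set of rank `k` keep the rank and rule out a good event. -/
theorem idx_eq_rankIdx_of_sliceSucc {q q' : Q} (hq : SliceSucc A a t q q') (hq' : q' ∉ A.acc)
    (hqk : idx t q = rankIdx t k) :
    k ∉ good (step A a fs t) ∧
      idx (normalize (merge bs)) q' = rankIdx (normalize (merge bs)) k := by
  have hslice := isSlice_of_grouping A a ht hfs hb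
  obtain ⟨L, S, R, L', Y, R', rfl, hm, hY, hSY, hR', hgood⟩ :=
    exists_split_of_rank ht hfs hb hk1 hkt hk hbad
  rw [hm] at hslice ⊢
  rw [rankIdx_split ht.nodup] at hqk
  rw [rankIdx_split hslice.nodup]
  obtain ⟨hqt, hqq, hmin⟩ := hq
  have hqS : q ∈ S := by
    have h1 := idx_split_le.1 hqk.le
    have h2 := mt (idx_append_lt (M := (S, k) :: R)).2 hqk.not_lt
    simp only [Finset.mem_union] at h1
    tauto
  have hpost : q' ∉ A.post a (states L) := by
    intro h
    obtain ⟨x, hx, hxq⟩ := NBA.mem_post.1 h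
    have h1 := hmin x (by simp [hx]) hxq
    have h2 := (idx_append_lt (M := (S, k) :: R)).2 hx
    omega
  have hq2 : q' ∈ (A.post a S \ A.post a (states L)) \ A.acc := by
    simp only [Finset.mem_sdiff]
    exact ⟨⟨NBA.mem_post.2 ⟨q, hqS, hqq⟩, hpost⟩, hq'⟩
  refine ⟨fun h => ?_, idx_split (hSY hq2) fun h => ?_⟩
  · rw [hgood h] at hq2
    simp at hq2
  · exact Finset.disjoint_left.1 (disjoint_states hslice.disjoint) h
      (by simp [hSY hq2])

end Persist

end RankedTuple

/-! ### Infinite paths -/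

/-- There is a path of `n` edges from `x`, at level `j`, that stays in the sets `H`. -/
def HasPath {V : Type*} (E : ℕ → V → V → Prop) (H : ℕ → Finset V) : ℕ → ℕ → V → Prop
  | 0, j, x => x ∈ H j
  | n + 1, j, x => x ∈ H j ∧ ∃ y, E j x y ∧ HasPath E H n (j + 1) y

theorem HasPath.mem {V : Type*} {E : ℕ → V → V → Prop} {H : ℕ → Finset V} {n j : ℕ} {x : V}
    (h : HasPath E H n j x) : x ∈ H j := by
  cases n with
  | zero => exact h
  | succ n => exact h.1

theorem HasPath.of_succ {V : Type*} {E : ℕ → V → V → Prop} {H : ℕ → Finset V} {n j : ℕ} {x : V}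
    (h : HasPath E H (n + 1) j x) : HasPath E H n j x := by
  induction n generalizing j x with
  | zero => exact h.1
  | succ n ih =>
    obtain ⟨hx, y, hxy, hy⟩ := h
    exact ⟨hx, y, hxy, ih hy⟩

theorem exists_forall_of_antitone {V : Type*} (s : Finset V) (P : ℕ → V → Prop)
    (hP : ∀ n x, P (n + 1) x → P n x) (h : ∀ n, ∃ x ∈ s, P n x) : ∃ x ∈ s, ∀ n, P n x := by
  have hanti : ∀ x n m, n ≤ m → P m x → P n x := by
    intro x n m hnm
    induction hnm with
    | refl => exact id
    | step _ ih => exact fun h => ih (hP _ _ h)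
  by_contra! hc
  choose! f hf using hc
  obtain ⟨x, hx, hxP⟩ := h (s.sup f)
  exact hf x hx (hanti x _ _ (Finset.le_sup hx) hxP)

/-- König's lemma for a sequence of finite nonempty levels in which every vertex has a
predecessor. -/
theorem exists_infinite_path {V : Type*} (E : ℕ → V → V → Prop) (H : ℕ → Finset V)
    (hne : ∀ j, (H j).Nonempty) (hE : ∀ j, ∀ y ∈ H (j + 1), ∃ x ∈ H j, E j x y) :
    ∃ ρ : ℕ → V, ∀ j, ρ j ∈ H j ∧ E j (ρ j) (ρ (j + 1)) := by
  have hpath : ∀ n j, ∃ x ∈ H j, HasPath E H n j x := by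
    intro n
    induction n with
    | zero => exact fun j => (hne j).imp fun x hx => ⟨hx, hx⟩
    | succ n ih =>
      intro j
      obtain ⟨y, hy, hyP⟩ := ih (j + 1)
      obtain ⟨x, hx, hxy⟩ := hE j y hy
      exact ⟨x, hx, hx, y, hxy, hyP⟩
  obtain ⟨x₀, -, hx₀⟩ := exists_forall_of_antitone (H 0) (fun n => HasPath E H n 0)
    (fun _ _ => HasPath.of_succ) (fun n => hpath n 0)
  have hstep : ∀ j x, ∃ y, (∀ n, HasPath E H n j x) →
      E j x y ∧ ∀ n, HasPath E H n (j + 1) y := by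
    intro j x
    by_cases h : ∀ n, HasPath E H n j x
    · obtain ⟨y, -, hy⟩ := exists_forall_of_antitone (H (j + 1))
        (fun n y => E j x y ∧ HasPath E H n (j + 1) y) (fun _ _ h => ⟨h.1, h.2.of_succ⟩) (fun n => by
          obtain ⟨-, y, hxy, hy⟩ := h (n + 1)
          exact ⟨y, hy.mem, hxy, hy⟩)
      exact ⟨y, fun _ => ⟨(hy 0).1, fun n => (hy n).2⟩⟩
    · exact ⟨x, fun h' => absurd h' h⟩
  choose next hnext using hstep
  let ρ : ℕ → V := fun n => Nat.rec x₀ next n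
  have hρ : ∀ j, ∀ n, HasPath E H n j (ρ j) := by
    intro j
    induction j with
    | zero => exact hx₀
    | succ j ih => exact (hnext j (ρ j) ih).2
  exact ⟨ρ, fun j => ⟨(hρ j 0).mem, (hnext j (ρ j) (hρ j)).1⟩⟩

namespace RankedTuple

variable {Q X : Type*} [DecidableEq Q]

/-! ### Soundness: good events yield accepting runs -/

/-- The properties of a sequence of tuples, read along a word `w`, in which the rank `k` is present,
never disappears, no smaller rank has an event, and a good event of `k` (recorded by `G`) occurs
infinitely often. -/
structure RankTrace (A : NBA Q X) (w : ℕ → X) (t : ℕ → RankedTuple Q) (k : ℕ) (G : ℕ → Prop) :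
    Prop where
  nonempty : ∀ j, (upto (t j) k).Nonempty
  /-- What is strictly to the right of the set of rank `k` stays there. -/
  upto_subset : ∀ j, upto (t (j + 1)) k ⊆ A.post (w j) (upto (t j) k)
  /-- Along a nonaccepting edge from `q` to `q'`, no successor of a state weakly to the left of `q`
  gets strictly to the right of `q'`. -/
  idx_le : ∀ {j q q' p p'}, SliceSucc A (w j) (t j) q q' → q' ∉ A.acc → q' ∈ states (t (j + 1)) →
    p ∈ states (t j) → p' ∈ A.next p (w j) → p' ∈ states (t (j + 1)) →
    idx (t j) p ≤ idx (t j) q → idx (t (j + 1)) p' ≤ idx (t (j + 1)) q'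
  /-- If a nonaccepting edge from `q` ends strictly to the left of the set of rank `k`, then there
  are states between `q` and the end of the set of rank `k`, even if the omission of states has made
  that set empty. -/
  exists_right : ∀ {j q q'}, SliceSucc A (w j) (t j) q q' → q' ∉ A.acc → q' ∈ states (t (j + 1)) →
    idx (t (j + 1)) q' < rankIdx (t (j + 1)) k → ∃ p ∈ upto (t j) k, idx (t j) q < idx (t j) p
  /-- Nonaccepting edges from the set of rank `k` remain in it and exclude a good event of `k`. -/
  stay : ∀ {j q q'}, SliceSucc A (w j) (t j) q q' → q' ∉ A.acc → q' ∈ states (t (j + 1)) →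
    idx (t j) q = rankIdx (t j) k → ¬ G j ∧ idx (t (j + 1)) q' = rankIdx (t (j + 1)) k
  often : ∃ᶠ j in atTop, G j

theorem RankTrace.shift {A : NBA Q X} {w : ℕ → X} {t : ℕ → RankedTuple Q} {k : ℕ} {G : ℕ → Prop}
    (h : RankTrace A w t k G) (n : ℕ) :
    RankTrace A (fun j => w (n + j)) (fun j => t (n + j)) k (fun j => G (n + j)) where
  nonempty j := h.nonempty _
  upto_subset j := h.upto_subset _
  idx_le := h.idx_le
  exists_right := h.exists_right
  stay := h.stay
  often := by
    rw [frequently_atTop] at *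
    intro a
    obtain ⟨b, hb, hG⟩ := frequently_atTop.1 h.often (n + a)
    exact ⟨b - n, by omega, by rwa [Nat.add_sub_cancel' (by omega)]⟩

/-- The induction behind soundness. `H` is a final part of the states up to the set of rank `k`. By
König's lemma it contains an infinite run. If this run visits accepting states only finitely often,
then it never again enters the set of rank `k`, and the states strictly to its right are a smaller
such part. -/
theorem RankTrace.exists_run_of_family {A : NBA Q X} {k : ℕ} (c : ℕ) :
    ∀ {w : ℕ → X} {t : ℕ → RankedTuple Q} {G : ℕ → Prop}, RankTrace A w t k G →
    ∀ H : ℕ → Finset Q, (∀ j, H j ⊆ upto (t j) k) → (∀ j, (H j).Nonempty) →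
    (∀ j, (H j).card ≤ c) →
    (∀ j, ∀ q ∈ H j, ∀ p ∈ upto (t j) k, idx (t j) q ≤ idx (t j) p → p ∈ H j) →
    (∀ j, ∀ q' ∈ H (j + 1), ∃ q ∈ H j, SliceSucc A (w j) (t j) q q') →
    ∃ j, ∃ ρ : ℕ → Q, ρ 0 ∈ states (t j) ∧ (∀ i, ρ (i + 1) ∈ A.next (ρ i) (w (j + i))) ∧
      ∃ᶠ i in atTop, ρ i ∈ A.acc := by
  induction c with
  | zero =>
    intro w t G _ H _ hne hc
    exact absurd (hc 0) (by simpa using (hne 0).ne_empty)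
  | succ c ih =>
    intro w t G hT H hsub hne hc hright hpred
    obtain ⟨ρ, hρ⟩ := exists_infinite_path (fun j => SliceSucc A (w j) (t j)) H hne hpred
    by_cases hF : ∃ᶠ i in atTop, ρ i ∈ A.acc
    · exact ⟨0, ρ, (hρ 0).2.1, fun i => by simpa using (hρ i).2.2.1, hF⟩
    rw [not_frequently, eventually_atTop] at hF
    obtain ⟨n, hn⟩ := hF
    have hst : ∀ j, ρ j ∈ states (t j) := fun j => (hρ j).2.1
    -- Once in the set of rank `k`, the run would stay there, and no good event could follow.
    have hstay : ∀ j, n ≤ j → idx (t j) (ρ j) ≠ rankIdx (t j) k := by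
      intro j hj heq
      have h1 : ∀ i, idx (t (j + i)) (ρ (j + i)) = rankIdx (t (j + i)) k := by
        intro i
        induction i with
        | zero => exact heq
        | succ i ih => exact (hT.stay (hρ _).2 (hn _ (by omega)) (hst _) ih).2
      obtain ⟨b, hb, hG⟩ := frequently_atTop.1 hT.often j
      obtain ⟨i, rfl⟩ := Nat.exists_eq_add_of_le hb
      exact (hT.stay (hρ _).2 (hn _ (by omega)) (hst _) (h1 i)).1 hG
    have hlt : ∀ j, n ≤ j → idx (t j) (ρ j) < rankIdx (t j) k := fun j hj =>
      lt_of_le_of_ne (mem_upto.1 (hsub j (hρ j).1)).2 (hstay j hj)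
    have hmemH : ∀ j q, q ∈ (upto (t (n + j)) k).filter
        (fun q => idx (t (n + j)) (ρ (n + j)) < idx (t (n + j)) q) ↔
        q ∈ upto (t (n + j)) k ∧ idx (t (n + j)) (ρ (n + j)) < idx (t (n + j)) q :=
      fun j q => Finset.mem_filter
    -- The states up to the set of rank `k` and strictly to the right of the run.
    obtain ⟨j, σ, h1, h2, h3⟩ := ih (hT.shift n)
      (fun j => (upto (t (n + j)) k).filter
        fun q => idx (t (n + j)) (ρ (n + j)) < idx (t (n + j)) q)
      (fun j => Finset.filter_subset _ _)
      (fun j => by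
        obtain ⟨p, hp, hp'⟩ := hT.exists_right (hρ (n + j)).2 (hn _ (by omega)) (hst _)
          (hlt _ (by omega))
        exact ⟨p, (hmemH j p).2 ⟨hp, hp'⟩⟩)
      (fun j => by
        have hss : (upto (t (n + j)) k).filter
            (fun q => idx (t (n + j)) (ρ (n + j)) < idx (t (n + j)) q) ⊂ H (n + j) := by
          refine (Finset.ssubset_iff_of_subset ?_).2 ⟨ρ (n + j), (hρ _).1, ?_⟩
          · intro q hq
            have hq' := (hmemH j q).1 hq
            exact hright _ _ (hρ _).1 q hq'.1 hq'.2.le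
          · rw [hmemH]
            exact fun h => lt_irrefl _ h.2
        have := (Finset.card_lt_card hss).trans_le (hc (n + j))
        omega)
      (fun j q hq p hp hle => by
        rw [hmemH] at hq ⊢
        exact ⟨hp, hq.2.trans_le hle⟩)
      (fun j q' hq' => by
        have hq2 := (hmemH (j + 1) q').1 hq'
        obtain ⟨q, hq, hqs⟩ :=
          exists_sliceSucc_of_mem_post_upto (hT.upto_subset (n + j) hq2.1)
        refine ⟨q, (hmemH j q).2 ⟨hq, ?_⟩, hqs⟩
        by_contra hle
        have h1 := hT.idx_le (hρ (n + j)).2 (hn _ (by omega)) (hst _) hqs.1 hqs.2.1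
          (mem_upto.1 hq2.1).1 (not_lt.1 hle)
        exact absurd hq2.2 (not_lt.2 h1))
    exact ⟨n + j, σ, h1, fun i => by simpa [Nat.add_assoc] using h2 i, h3⟩

theorem RankTrace.exists_run [Fintype Q] {A : NBA Q X} {w : ℕ → X} {t : ℕ → RankedTuple Q} {k : ℕ}
    {G : ℕ → Prop} (hT : RankTrace A w t k G) :
    ∃ j, ∃ ρ : ℕ → Q, ρ 0 ∈ states (t j) ∧ (∀ i, ρ (i + 1) ∈ A.next (ρ i) (w (j + i))) ∧
      ∃ᶠ i in atTop, ρ i ∈ A.acc :=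
  hT.exists_run_of_family (Fintype.card Q) (fun j => upto (t j) k) (fun _ => subset_rfl)
    hT.nonempty (fun _ => Finset.card_le_univ _) (fun _ _ _ _ hp _ => hp)
    (fun j _ hq' => exists_sliceSucc_of_mem_post_upto (hT.upto_subset j hq'))

end RankedTuple

/-! ### Completeness: the smallest rank of a segment -/

/-- The smallest number in the longest prefix of the list that consists of numbers `≥ k`, where `d`
counts as a further element of this prefix. -/
def segMin (k d : ℕ) : List ℕ → ℕ
  | [] => d
  | x :: l => if k ≤ x then min x (segMin k d l) else d

theorem segMin_le (k d : ℕ) (l : List ℕ) : segMin k d l ≤ d := by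
  induction l with
  | nil => exact le_rfl
  | cons x l ih =>
    rw [segMin]
    split_ifs
    · exact (min_le_right _ _).trans ih
    · exact le_rfl

theorem segMin_mem {k d : ℕ} {l : List ℕ} (h : segMin k d l < d) :
    segMin k d l ∈ l ∧ k ≤ segMin k d l := by
  induction l with
  | nil => exact absurd h (lt_irrefl _)
  | cons x l ih =>
    rw [segMin] at h ⊢
    split_ifs at h ⊢ with hx
    · rcases min_choice x (segMin k d l) with h1 | h1
      · rw [h1]
        exact ⟨List.mem_cons_self, hx⟩
      · rw [h1] at h ⊢
        exact ⟨List.mem_cons_of_mem _ (ih h).1, (ih h).2⟩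
    · exact absurd h (lt_irrefl _)

theorem segMin_map_le {k d : ℕ} {l : List ℕ} {g : ℕ → ℕ} (hg : ∀ x, g x ≤ x)
    (hk : ∀ x ∈ l, k ≤ x → k ≤ g x) : segMin k d (l.map g) ≤ segMin k d l := by
  induction l with
  | nil => exact le_rfl
  | cons x l ih =>
    by_cases hx : k ≤ x
    · rw [List.map_cons, segMin, segMin, if_pos hx, if_pos (hk x List.mem_cons_self hx)]
      exact min_le_min (hg x) (ih fun y hy => hk y (List.mem_cons_of_mem _ hy))
    · rw [segMin.eq_2 k d x l, if_neg hx]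
      exact segMin_le _ _ _

theorem segMin_map_lt {k d : ℕ} {l : List ℕ} {g : ℕ → ℕ}
    (hk : ∀ x ∈ l, k ≤ x → k ≤ g x ∧ g x < x) (h : segMin k d l < d) :
    segMin k d (l.map g) < segMin k d l := by
  induction l with
  | nil => exact absurd h (lt_irrefl _)
  | cons x l ih =>
    by_cases hx : k ≤ x
    · have h1 := hk x List.mem_cons_self hx
      rw [segMin, if_pos hx] at h
      rw [List.map_cons, segMin, segMin, if_pos hx, if_pos h1.1]
      by_cases h2 : segMin k d l < d
      · have := ih (fun y hy => hk y (List.mem_cons_of_mem _ hy)) h2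
        omega
      · omega
    · rw [segMin, if_neg hx] at h
      exact absurd h (lt_irrefl _)

theorem min_le_segMin_append {k d m z : ℕ} {l l' : List ℕ} (hl : ∀ x ∈ l, k ≤ x ∧ m ≤ x)
    (hz : z ≤ segMin k d l') : min m z ≤ segMin k d (l ++ l') := by
  induction l with
  | nil => exact (min_le_right _ _).trans hz
  | cons x l ih =>
    have h1 := hl x List.mem_cons_self
    rw [List.cons_append, segMin, if_pos h1.1]
    exact le_min ((min_le_left _ _).trans h1.2) (ih fun y hy => hl y (List.mem_cons_of_mem _ hy))

namespace RankedTuple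

variable {Q X : Type*} [DecidableEq Q]

theorem segMin_stepAux_le (A : NBA Q X) (a : X) {k d : ℕ} (U : Finset Q) {fs : List ℕ}
    {t : RankedTuple Q} (h : fs.length = t.length) (hk : ∀ f ∈ fs, k ≤ f) :
    segMin k d ((stepAux A a U fs t).map Prod.snd) ≤ segMin k d (t.map Prod.snd) := by
  induction t generalizing U fs with
  | nil => simp [stepAux]
  | cons e t ih =>
    obtain ⟨S, r⟩ := e
    cases fs with
    | nil => simp at h
    | cons f fs =>
      have h1 := ih (U ∪ A.post a S) (by simpa using h)
        (fun x hx => hk x (List.mem_cons_of_mem _ hx))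
      have hf := hk f List.mem_cons_self
      rw [stepAux_cons]
      simp only [List.map_cons, segMin, if_pos hf]
      split_ifs
      · omega
      · omega

theorem foldr_min_comm (l : RankedTuple Q) (x r : ℕ) :
    l.foldr (fun e k => min e.2 k) (min x r) = min x (l.foldr (fun e k => min e.2 k) r) := by
  induction l with
  | nil => rfl
  | cons e l ih =>
    rw [List.foldr_cons, ih, List.foldr_cons]
    omega

theorem segMin_prune_le {k d : ℕ} {S : Finset Q} (hS : S ≠ ∅) (r : ℕ) {C : RankedTuple Q}
    (hC : ∀ x, (∅, x) ∈ C → k ≤ x) :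
    segMin k d ((prune ((S, r) :: C)).map Prod.snd) ≤ segMin k d (r :: C.map Prod.snd) := by
  induction C generalizing S r with
  | nil => simp [prune, hS]
  | cons e C ih =>
    obtain ⟨T, x⟩ := e
    have hC' : ∀ x, (∅, x) ∈ C → k ≤ x := fun y hy => hC y (List.mem_cons_of_mem _ hy)
    by_cases hT : T = ∅
    · subst hT
      have h1 : prune ((S, r) :: (∅, x) :: C) = prune ((S, min x r) :: C) := by
        rw [prune_cons_of_ne hS, prune_cons_of_ne hS, prune, if_pos rfl,
          List.takeWhile_cons_of_pos (by simp), List.foldr_cons, foldr_min_comm]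
      have hx : k ≤ x := hC x List.mem_cons_self
      rw [h1]
      refine (ih hS (min x r) hC').trans ?_
      simp only [List.map_cons, segMin, le_min_iff, hx, true_and]
      split_ifs
      · omega
      · exact le_rfl
    · have h1 : prune ((S, r) :: (T, x) :: C) = (S, r) :: prune ((T, x) :: C) := by
        rw [prune_cons_of_ne hS, List.takeWhile_cons_of_neg (by simpa using hT), List.foldr_nil]
      rw [h1]
      have h2 := ih hT x hC'
      rw [List.map_cons, segMin, segMin]
      split_ifs
      · exact min_le_min le_rfl h2
      · exact le_rfl

theorem segMin_merge_le {k d : ℕ} {bs : List (RankedTuple Q)}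
    (h : ∀ b ∈ bs, b.length = 1 ∨ ∀ e ∈ b, k ≤ e.2) (hne : ∀ b ∈ bs, b ≠ []) :
    segMin k d ((merge bs).map Prod.snd) ≤ segMin k d (bs.flatten.map Prod.snd) := by
  induction bs with
  | nil => exact le_rfl
  | cons b bs ih =>
    have ih' := ih (fun b hb => h b (List.mem_cons_of_mem _ hb))
      (fun b hb => hne b (List.mem_cons_of_mem _ hb))
    have h1 : merge (b :: bs) = (states b, minRank b) :: merge bs := rfl
    rw [h1, List.map_cons, List.flatten_cons, List.map_append]
    rcases h b List.mem_cons_self with hb | hb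
    · obtain ⟨e, rfl⟩ := List.length_eq_one_iff.1 hb
      simp only [minRank, List.map_cons, List.map_nil, List.min?_singleton, Option.getD_some,
        List.singleton_append, segMin]
      split_ifs
      · exact min_le_min le_rfl ih'
      · exact le_rfl
    · obtain ⟨y, hy, hyb⟩ := List.mem_map.1 (minRank_mem (hne b List.mem_cons_self))
      rw [segMin, if_pos (hyb ▸ hb y hy)]
      refine min_le_segMin_append ?_ ih'
      intro x hx
      obtain ⟨e, he, rfl⟩ := List.mem_map.1 hx
      exact ⟨hb e he, minRank_le he⟩

/-- Merging the first set of a segment also with sets on its left does not raise the smallest rank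
of the segment. -/
theorem segMin_merge_cons_le {k d : ℕ} {bs : List (RankedTuple Q)} {b₁ b₂ : RankedTuple Q}
    {e : Finset Q × ℕ}
    (hb : (b₁ ++ e :: b₂).length = 1 ∨ ∀ x ∈ b₁ ++ e :: b₂, k ≤ x.2)
    (h : ∀ b ∈ bs, b.length = 1 ∨ ∀ e ∈ b, k ≤ e.2) (hne : ∀ b ∈ bs, b ≠ []) :
    segMin k d (minRank (b₁ ++ e :: b₂) :: (merge bs).map Prod.snd) ≤
      segMin k d ((e :: (b₂ ++ bs.flatten)).map Prod.snd) := by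
  have h1 := segMin_merge_le (d := d) h hne
  rw [← List.cons_append, List.map_append]
  rcases hb with hb | hb
  · rw [List.length_append, List.length_cons] at hb
    have e1 : b₁ = [] := List.eq_nil_of_length_eq_zero (by omega)
    have e2 : b₂ = [] := List.eq_nil_of_length_eq_zero (by omega)
    subst e1 e2
    simp only [minRank, List.map_cons, List.map_nil, List.min?_singleton, Option.getD_some,
      List.singleton_append, List.nil_append, segMin]
    split_ifs
    · exact min_le_min le_rfl h1
    · exact le_rfl
  · obtain ⟨y, hy, hyb⟩ := List.mem_map.1 (minRank_mem (b := b₁ ++ e :: b₂) (by simp))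
    rw [segMin, if_pos (hyb ▸ hb y hy)]
    refine min_le_segMin_append ?_ h1
    intro x hx
    obtain ⟨z, hz, rfl⟩ := List.mem_map.1 hx
    have hz' : z ∈ b₁ ++ e :: b₂ := List.mem_append_right _ hz
    exact ⟨hb z hz', minRank_le hz'⟩

/-! ### Completeness: the leftmost live set -/

variable [Fintype Q] {A : NBA Q X} {a : X} {t : RankedTuple Q} {fs : List ℕ}
  {bs : List (RankedTuple Q)}

/-- If no rank below `k` has an event, then `prune`, `merge` and `normalize` do not increase the
smallest rank of the segment that starts at a nonempty set, and they decrease it if `k` disappears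
and the segment is nonempty. -/
theorem exists_split_segMin_le (ht : IsPreSlice t)
    (hfs : fs.Perm (List.range' (t.length + 1) t.length))
    (hb : IsGrouping (domRank (step A a fs t)) (prune (step A a fs t)) bs) {k d : ℕ}
    (hk1 : 1 ≤ k) (hkt : k ≤ t.length + 1) (hk : k ≤ domRank (step A a fs t))
    {L C : RankedTuple Q} {S : Finset Q} {r : ℕ} (hs : step A a fs t = L ++ (S, r) :: C)
    (hS : S ≠ ∅) :
    ∃ L' Y y R', normalize (merge bs) = L' ++ (Y, y) :: R' ∧ S ⊆ Y ∧ states L' ⊆ states L ∧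
      segMin k d (y :: R'.map Prod.snd) ≤ segMin k d (r :: C.map Prod.snd) ∧
      (k ∈ bad (step A a fs t) → segMin k d (r :: C.map Prod.snd) < d →
        segMin k d (y :: R'.map Prod.snd) < segMin k d (r :: C.map Prod.snd)) := by
  have hnd := nodup_ranks_merge ht hfs hb
  have hpos : ∀ x ∈ (merge bs).map Prod.snd, 1 ≤ x := fun _ hx =>
    ((mem_ranks_step A a ht hfs).1 (mem_ranks_step_of_mem_ranks_merge hb hx)).1
  have hbelow : ∀ y, 1 ≤ y → y < k → y ∈ (merge bs).map Prod.snd := by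
    intro y hy hyk
    refine hb.mem_ranks_merge (by omega) (mem_ranks_prune_of_lt ?_ (by omega))
    exact (mem_ranks_step A a ht hfs).2 ⟨hy, by omega⟩
  have hge : ∀ x ∈ (merge bs).map Prod.snd, k ≤ x → k ≤ newRank (merge bs) x :=
    fun x hx hkx => le_newRank hnd hbelow hx hkx
  have hle := newRank_le hnd hpos
  have hlt : k ∈ bad (step A a fs t) → ∀ x, k ≤ x → newRank (merge bs) x < x := by
    intro hbad x hkx
    exact newRank_lt hnd hpos (fun h => (mem_bad.1 hbad).2 (hb.ranks_merge_subset h)) hk1 hkx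
  have hempty : ∀ x, (∅, x) ∈ C → k ≤ x := fun x hx =>
    hk.trans (domRank_le_of_empty (by rw [hs]; simp [hx]))
  have hrank : ∀ b ∈ bs, b.length = 1 ∨ ∀ e ∈ b, k ≤ e.2 := fun b hbm =>
    (hb.rank_le_of_mem hbm).imp_right fun h e he => hk.trans (h e he)
  have hflat := hb.1
  have hpr : _ ≤ segMin k d (r :: C.map Prod.snd) := segMin_prune_le hS r hempty
  rw [hs, prune_append hS] at hflat
  rw [prune_cons_of_ne hS] at hflat hpr
  generalize (C.takeWhile _).foldr _ r = z at hflat hpr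
  obtain ⟨bs₁, b₁, b₂, bs₂, rfl, h1, h2⟩ := flatten_split hflat
  rw [h2] at hpr
  have hmg := (segMin_merge_cons_le (d := d) (b₁ := b₁) (b₂ := b₂) (e := (S, z)) (hrank _ (by simp))
    (fun b hbm => hrank b (by simp [hbm])) (fun b hbm => (hb.2 b (by simp [hbm])).1)).trans hpr
  have h1' := congrArg states h1
  rw [states_prune, states_append] at h1'
  rw [normalize_eq]
  generalize newRank (merge (bs₁ ++ (b₁ ++ _ :: b₂) :: bs₂)) = g at *
  rw [merge_append_cons] at *
  rw [List.map_append, List.map_cons]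
  simp only [List.map_append, List.map_cons, List.mem_append, List.mem_cons] at hge
  have hcomp : ∀ l : RankedTuple Q, (l.map fun e => (e.1, g e.2)).map Prod.snd =
      (l.map Prod.snd).map g := fun l => by simp
  refine ⟨_, _, _, _, rfl, ?_, ?_, ?_, ?_⟩
  · simp only [states_append, states_cons]
    exact Finset.subset_union_left.trans Finset.subset_union_right
  · rw [states_map_rank, states_merge, h1']
    exact Finset.subset_union_left
  · rw [hcomp, ← List.map_cons (f := g)]
    exact (segMin_map_le hle fun x hx => hge x (Or.inr (List.mem_cons.1 hx))).trans hmg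
  · intro hbad hd
    rw [hcomp, ← List.map_cons (f := g)]
    exact (segMin_map_lt (fun x hx hkx => ⟨hge x (Or.inr (List.mem_cons.1 hx)) hkx,
      hlt hbad x hkx⟩) (hmg.trans_lt hd)).trans_le hmg

/-- The development of the leftmost set with a live state in one transition, where `P` and `P'`
are the sets of live states before and after it. -/
theorem exists_leftmost_next (ht : IsPreSlice t)
    (hfs : fs.Perm (List.range' (t.length + 1) t.length))
    (hb : IsGrouping (domRank (step A a fs t)) (prune (step A a fs t)) bs) {k d : ℕ}
    (hk1 : 1 ≤ k) (hkt : k ≤ t.length + 1) (hk : k ≤ domRank (step A a fs t))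
    (hd : 2 * Fintype.card Q < d)
    {P P' : Q → Prop} (hP : ∀ q, ∀ q' ∈ A.next q a, P' q' → P q)
    {L R : RankedTuple Q} {S : Finset Q} {r : ℕ} (hL : t = L ++ (S, r) :: R)
    (hdead : ∀ q ∈ states L, ¬ P q) {p p' : Q} (hp : p ∈ S) (hpp : p' ∈ A.next p a) (hp' : P' p') :
    ∃ L' Y y R' q, normalize (merge bs) = L' ++ (Y, y) :: R' ∧ (∀ q ∈ states L', ¬ P' q) ∧
      q ∈ Y ∧ P' q ∧
      segMin k d (y :: R'.map Prod.snd) ≤ segMin k d (r :: R.map Prod.snd) ∧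
      (k ∈ bad (step A a fs t) → segMin k d (r :: R.map Prod.snd) < d →
        segMin k d (y :: R'.map Prod.snd) < segMin k d (r :: R.map Prod.snd)) ∧
      (q = p' ∧ p' ∉ A.acc ∨ segMin k d (y :: R'.map Prod.snd) < d) := by
  have hdead' : ∀ q ∈ A.post a (states L), ¬ P' q := by
    intro q hq hPq
    obtain ⟨x, hx, hxq⟩ := NBA.mem_post.1 hq
    exact hdead x hx (hP x q hxq hPq)
  have hfresh : ∀ f ∈ fs, k ≤ f ∧ f < d := by
    intro f hf
    have h1 := List.mem_range'_1.1 (hfs.mem_iff.1 hf)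
    have h2 := ht.length_le
    omega
  subst hL
  obtain ⟨L₁, f, fs', hs, hL₁, hf, hsub, hlen⟩ := step_split A a (length_eq_of_perm hfs)
  have hT : p' ∈ A.post a S \ A.post a (states L) :=
    Finset.mem_sdiff.2 ⟨NBA.mem_post.2 ⟨p, hp, hpp⟩, fun h => hdead' p' h hp'⟩
  have hseg : segMin k d (r :: (stepAux A a (A.post a (states L ∪ S)) fs' R).map Prod.snd) ≤
      segMin k d (r :: R.map Prod.snd) := by
    rw [segMin, segMin]
    split_ifs
    · exact min_le_min le_rfl (segMin_stepAux_le A a _ hlen fun x hx => (hfresh x (hsub hx)).1)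
    · exact le_rfl
  by_cases hacc : ∃ q ∈ (A.post a S \ A.post a (states L)) ∩ A.acc, P' q
  · obtain ⟨q, hq, hPq⟩ := hacc
    obtain ⟨L', Y, y, R', hm, hSY, hL', h1, h2⟩ := exists_split_segMin_le ht hfs hb
      (d := d) hk1 hkt hk hs (Finset.ne_empty_of_mem hq)
    rw [List.map_cons, segMin.eq_2 k d f, if_pos (hfresh f hf).1] at h1 h2
    dsimp only at h1 h2
    have hfd := (hfresh f hf).2
    refine ⟨L', Y, y, R', q, hm, fun x hx => hdead' x (hL₁ ▸ hL' hx), hSY hq, hPq, by omega,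
      fun hbad hlt => ?_, Or.inr (by omega)⟩
    have := h2 hbad (by omega)
    omega
  · push Not at hacc
    have hpacc : p' ∉ A.acc := fun h => hacc p' (Finset.mem_inter.2 ⟨hT, h⟩) hp'
    have hpT : p' ∈ (A.post a S \ A.post a (states L)) \ A.acc :=
      Finset.mem_sdiff.2 ⟨hT, hpacc⟩
    rw [List.append_cons L₁] at hs
    obtain ⟨L', Y, y, R', hm, hSY, hL', h1, h2⟩ := exists_split_segMin_le ht hfs hb
      (d := d) hk1 hkt hk hs (Finset.ne_empty_of_mem hpT)
    refine ⟨L', Y, y, R', p', hm, fun x hx => ?_, hSY hpT, hp', h1.trans hseg,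
      fun hbad hlt => (h2 hbad (hseg.trans_lt hlt)).trans_le hseg, Or.inl ⟨rfl, hpacc⟩⟩
    have hx' := hL' hx
    rw [states_append, hL₁, states_cons, states_nil, Finset.union_empty, Finset.mem_union] at hx'
    exact hx'.elim (hdead' x) (hacc x)

theorem exists_leftmost {P : Q → Prop} (h : ∃ q ∈ states t, P q) :
    ∃ L S r R q, t = L ++ (S, r) :: R ∧ (∀ q ∈ states L, ¬ P q) ∧ q ∈ S ∧ P q := by
  induction t with
  | nil => simp at h
  | cons e t ih =>
    by_cases he : ∃ q ∈ e.1, P q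
    · obtain ⟨q, hq, hPq⟩ := he
      exact ⟨[], e.1, e.2, t, q, rfl, by simp, hq, hPq⟩
    · push Not at he
      obtain ⟨q, hq, hPq⟩ := h
      rw [states_cons, Finset.mem_union] at hq
      obtain ⟨L, S, r, R, q, rfl, h1, h2, h3⟩ :=
        ih ⟨q, hq.resolve_left fun h => he q h hPq, hPq⟩
      refine ⟨e :: L, S, r, R, q, rfl, ?_, h2, h3⟩
      intro x hx
      rw [states_cons, Finset.mem_union] at hx
      exact hx.elim (he x) (h1 x)

end RankedTuple

namespace NBA

variable {Q X : Type*}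

/-! ### Live states -/

/-- The state `q` accepts the rest of the word `w` from position `j` on. -/
def Live (A : NBA Q X) (w : ℕ → X) (j : ℕ) (q : Q) : Prop := (fun i => w (j + i)) ∈ A.lang {q}

theorem live_of_run {A : NBA Q X} {w : ℕ → X} {j : ℕ} {ρ : ℕ → Q}
    (h : ∀ i, ρ (i + 1) ∈ A.next (ρ i) (w (j + i))) (hF : ∃ᶠ i in atTop, ρ i ∈ A.acc) :
    A.Live w j (ρ 0) :=
  ⟨ρ, ⟨by simp, h⟩, hF⟩

theorem frequently_add_iff {P : ℕ → Prop} (n : ℕ) :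
    (∃ᶠ i in atTop, P (i + n)) ↔ ∃ᶠ i in atTop, P i := by
  conv_rhs => rw [← map_add_atTop_eq_nat n, frequently_map]

theorem Live.exists_run {A : NBA Q X} {w : ℕ → X} {j : ℕ} {q : Q} (h : A.Live w j q) :
    ∃ ρ : ℕ → Q, ρ 0 = q ∧ (∀ i, ρ (i + 1) ∈ A.next (ρ i) (w (j + i))) ∧
      (∀ i, A.Live w (j + i) (ρ i)) ∧ ∃ᶠ i in atTop, ρ i ∈ A.acc := by
  obtain ⟨ρ, ⟨h0, h1⟩, hF⟩ := h
  refine ⟨ρ, by simpa using h0, h1, fun i => ?_, hF⟩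
  have h2 := live_of_run (A := A) (w := w) (j := j + i) (ρ := fun n => ρ (n + i)) (fun n => by
    have := h1 (i + n)
    rw [show n + 1 + i = i + n + 1 by omega, show n + i = i + n by omega,
      show j + i + n = j + (i + n) by omega]
    exact this) ((frequently_add_iff i).2 hF)
  simpa using h2

theorem Live.exists_next {A : NBA Q X} {w : ℕ → X} {j : ℕ} {q : Q} (h : A.Live w j q) :
    ∃ q' ∈ A.next q (w j), A.Live w (j + 1) q' := by
  obtain ⟨ρ, rfl, h1, h2, -⟩ := h.exists_run
  exact ⟨ρ 1, by simpa using h1 0, h2 1⟩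

theorem Live.of_next {A : NBA Q X} {w : ℕ → X} {j : ℕ} {q q' : Q} (hq : q' ∈ A.next q (w j))
    (h : A.Live w (j + 1) q') : A.Live w j q := by
  obtain ⟨ρ, rfl, h1, -, hF⟩ := h.exists_run
  refine live_of_run (ρ := fun i => Nat.rec (motive := fun _ => Q) q (fun i _ => ρ i) i) ?_ ?_
  · rintro (_ | i)
    · simpa using hq
    · have := h1 i
      rwa [show j + 1 + i = j + (i + 1) by omega] at this
  · exact (frequently_add_iff 1).1 hF

theorem mem_lang_iff {A : NBA Q X} {w : ℕ → X} {P : Finset Q} :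
    w ∈ A.lang P ↔ ∃ p ∈ P, A.Live w 0 p := by
  constructor
  · rintro ⟨ρ, ⟨h0, h1⟩, hF⟩
    exact ⟨ρ 0, h0, live_of_run (by simpa using h1) hF⟩
  · rintro ⟨p, hp, h⟩
    obtain ⟨ρ, rfl, h1, -, hF⟩ := h.exists_run
    exact ⟨ρ, ⟨hp, by simpa using h1⟩, hF⟩

end NBA

/-! ### Runs of the construction with omissions -/

namespace NBA

open RankedTuple

variable {Q X : Type*} [DecidableEq Q] [Fintype Q] {A : NBA Q X}

/-- The states that `D` omits from a ranked slice are dominated by states further left. -/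
def Admissible (A : NBA Q X) (D : Macrostate Q → Finset Q) : Prop :=
  ∀ m : Macrostate Q, m.1.IsSlice → ∀ p ∈ D m, ∃ q : Q,
    A.lang {p} ⊆ A.lang {q} ∧ p ∈ m.1.states ∧ q ∈ m.1.states ∧ m.1.idx q < m.1.idx p

/-- The leftmost live states are not omitted. -/
theorem Admissible.notMem {D : Macrostate Q → Finset Q} (hD : A.Admissible D) {w : ℕ → X} {j : ℕ}
    {m : Macrostate Q} (hm : m.1.IsSlice) {L R : RankedTuple Q} {S : Finset Q} {r : ℕ}
    (h : m.1 = L ++ (S, r) :: R) (hdead : ∀ q ∈ states L, ¬ A.Live w j q) {p : Q} (hp : p ∈ S)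
    (hlive : A.Live w j p) : p ∉ D m := by
  intro hpD
  obtain ⟨q, hsub, -, -, hlt⟩ := hD m hm p hpD
  rw [h, idx_split hp fun hL => hdead p hL hlive, idx_append_lt] at hlt
  exact hdead q hlt (hsub hlive)

theorem startMacro_val (A : NBA Q X) :
    A.startMacro.1 = if A.start = ∅ then [] else [(A.start, 1)] := by
  by_cases h : A.start = ∅
  · rw [if_pos h]
    exact congrArg Subtype.val (dif_pos h : A.startMacro = _)
  · rw [if_neg h]
    exact congrArg Subtype.val (dif_neg h : A.startMacro = _)

theorem startMacro_isSlice (A : NBA Q X) : A.startMacro.1.IsSlice where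
  toIsPreSlice := A.startMacro.2
  nonempty := by
    rw [startMacro_val]
    split_ifs with h <;> simp [h]

theorem states_startMacro (A : NBA Q X) : states A.startMacro.1 = A.start := by
  rw [startMacro_val]
  split_ifs with h <;> simp [h]

variable (A) in
/-- The run of the construction with omissions. -/
abbrev macroRun (τ : Resolution A) (D : Macrostate Q → Finset Q) (w : ℕ → X) (j : ℕ) :
    Macrostate Q := (A.determinizeOmitting τ D).run w j

variable (A) in
/-- The tuple to which `prune` is applied in the `j`-th transition. -/
abbrev stepRun (τ : Resolution A) (D : Macrostate Q → Finset Q) (w : ℕ → X) (j : ℕ) :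
    RankedTuple Q :=
  (A.macroRun τ D w j).1.step A (w j) (τ.fresh (A.macroRun τ D w j) (w j))

variable {τ : Resolution A} {D : Macrostate Q → Finset Q} {w : ℕ → X}

theorem succMacro_isSlice (m : Macrostate Q) (a : X) : (A.succMacro τ m a).1.IsSlice :=
  isSlice_of_grouping A a m.2 (τ.fresh_perm m a) (τ.isGrouping m a)

theorem macroRun_succ (j : ℕ) : (A.macroRun τ D w (j + 1)).1 =
    (A.succMacro τ (A.macroRun τ D w j) (w j)).1.without
      (D (A.succMacro τ (A.macroRun τ D w j) (w j))) := rfl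

theorem states_succMacro (m : Macrostate Q) (a : X) :
    states (A.succMacro τ m a).1 = A.post a (states m.1) :=
  states_next (τ.fresh_perm m a) (τ.isGrouping m a)

theorem live_of_mem_macroRun {j : ℕ} {q : Q} (hq : q ∈ states (A.macroRun τ D w j).1)
    (h : A.Live w j q) : w ∈ A.lang A.start := by
  induction j generalizing q with
  | zero =>
    have h1 : q ∈ states (A.startMacro.1.without (D A.startMacro)) := hq
    rw [states_without, states_startMacro, Finset.mem_sdiff] at h1
    exact mem_lang_iff.2 ⟨q, h1.1, h⟩
  | succ j ih =>
    rw [macroRun_succ, states_without, states_succMacro, Finset.mem_sdiff] at hq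
    obtain ⟨p, hp, hpq⟩ := mem_post.1 hq.1
    exact ih hp (h.of_next hpq)

theorem Admissible.exists_live_without (hD : A.Admissible D) {m : Macrostate Q} (hm : m.1.IsSlice)
    {j : ℕ} (h : ∃ q ∈ states m.1, A.Live w j q) :
    ∃ q ∈ states (m.1.without (D m)), A.Live w j q := by
  obtain ⟨L, S, r, R, q, ht, hdead, hq, hlive⟩ := exists_leftmost h
  refine ⟨q, ?_, hlive⟩
  rw [states_without, Finset.mem_sdiff]
  exact ⟨by simp [ht, hq], hD.notMem hm ht hdead hq hlive⟩

theorem Admissible.exists_live (hD : A.Admissible D) (hw : w ∈ A.lang A.start) (j : ℕ) :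
    ∃ q ∈ states (A.macroRun τ D w j).1, A.Live w j q := by
  induction j with
  | zero =>
    refine hD.exists_live_without A.startMacro_isSlice ?_
    rw [states_startMacro]
    exact mem_lang_iff.1 hw
  | succ j ih =>
    refine hD.exists_live_without (succMacro_isSlice _ _) ?_
    obtain ⟨q, hq, hlive⟩ := ih
    obtain ⟨q', hq', hlive'⟩ := hlive.exists_next
    rw [states_succMacro]
    exact ⟨q', mem_post.2 ⟨q, hq, hq'⟩, hlive'⟩

theorem length_macroRun_succ {j k : ℕ} (hk : k ≤ domRank (A.stepRun τ D w j))
    (hbad : k ∉ bad (A.stepRun τ D w j)) (hkt : k ≤ 2 * (A.macroRun τ D w j).1.length) :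
    k ≤ (A.macroRun τ D w (j + 1)).1.length := by
  rw [macroRun_succ, without, List.length_map]
  exact le_length_next (A.macroRun τ D w j).2 (τ.fresh_perm _ _) (τ.isGrouping _ _) hk hbad hkt

theorem domRank_stepRun_bounds (j : ℕ) : 1 ≤ domRank (A.stepRun τ D w j) ∧
    domRank (A.stepRun τ D w j) ≤ 2 * Fintype.card Q + 1 := by
  rcases domRank_mem (A.stepRun τ D w j) with h | h
  · have h1 : domRank (A.stepRun τ D w j) ∈ (A.stepRun τ D w j).map Prod.snd := by
      rw [Finset.mem_union, mem_good, mem_bad] at h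
      exact h.elim (fun h => prune_ranks_subset _ _ h.1) And.left
    have h2 := (mem_ranks_step A (w j) (A.macroRun τ D w j).2 (τ.fresh_perm _ _)).1 h1
    have h3 := (A.macroRun τ D w j).2.length_le
    omega
  · omega

/-! ### Completeness: every accepted word of the Büchi automaton is accepted -/

/-- The leftmost set with a live state contains the live state `p`, and `v` is the smallest rank
`≥ k` in the segment from this set to the next set of rank `< k`. -/
def LeftmostLive (A : NBA Q X) (w : ℕ → X) (k : ℕ) (t : RankedTuple Q) (j : ℕ) (p : Q) (v : ℕ) :
    Prop :=
  ∃ L S r R, t = L ++ (S, r) :: R ∧ (∀ q ∈ states L, ¬ A.Live w j q) ∧ p ∈ S ∧ A.Live w j p ∧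
    segMin k (2 * Fintype.card Q + 1) (r :: R.map Prod.snd) = v

theorem Admissible.leftmostLive_succ (hD : A.Admissible D) {j k v : ℕ} {p p' : Q} (hk1 : 1 ≤ k)
    (hk : k ≤ domRank (A.stepRun τ D w j)) (hkt : k ≤ (A.macroRun τ D w j).1.length + 1)
    (h : A.LeftmostLive w k (A.macroRun τ D w j).1 j p v) (hp : p' ∈ A.next p (w j))
    (hp' : A.Live w (j + 1) p') :
    ∃ q v', A.LeftmostLive w k (A.macroRun τ D w (j + 1)).1 (j + 1) q v' ∧ v' ≤ v ∧
      (k ∈ bad (A.stepRun τ D w j) → v < 2 * Fintype.card Q + 1 → v' < v) ∧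
      (q = p' ∧ p' ∉ A.acc ∨ v' < 2 * Fintype.card Q + 1) := by
  obtain ⟨L, S, r, R, ht, hdead, hpS, -, rfl⟩ := h
  obtain ⟨L', Y, y, R', q, hm, hdead', hqY, hq, h1, h2, h3⟩ :=
    exists_leftmost_next (A.macroRun τ D w j).2 (τ.fresh_perm _ (w j)) (τ.isGrouping _ _) hk1 hkt hk
      (Nat.lt_succ_self _) (P := A.Live w j) (P' := A.Live w (j + 1))
      (fun _ _ hx hlive => hlive.of_next hx) ht hdead hpS hp hp'
  have hm' : (A.succMacro τ (A.macroRun τ D w j) (w j)).1 = L' ++ (Y, y) :: R' := hm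
  have hqD := hD.notMem (succMacro_isSlice _ _) hm' hdead' hqY hq
  have hsucc := macroRun_succ (τ := τ) (D := D) (w := w) j
  generalize D (A.succMacro τ (A.macroRun τ D w j) (w j)) = D' at hqD hsucc
  refine ⟨q, _, ⟨without L' D', _, y, without R' D', ?_, ?_, Finset.mem_sdiff.2 ⟨hqY, hqD⟩, hq, rfl⟩,
    ?_⟩
  · rw [hsucc, hm']
    simp [without]
  · intro x hx
    rw [states_without, Finset.mem_sdiff] at hx
    exact hdead' x hx.1
  · have hr : (without R' D').map Prod.snd = R'.map Prod.snd := by simp [without]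
    rw [hr]
    exact ⟨h1, h2, h3⟩

/-- Assume that from position `n` on no rank below `k` has an event, and that `k` disappears
infinitely often or exceeds the number of states. Then no macrostate from position `n` on has live
states, because otherwise the smallest rank `v` of the segment that starts at the leftmost live set
would decrease forever. The case `|Q| < k` covers transitions without any event. -/
theorem Admissible.not_leftmostLive (hD : A.Admissible D) {k n : ℕ} (hk1 : 1 ≤ k)
    (hk : ∀ j, n ≤ j → k ≤ domRank (A.stepRun τ D w j))
    (hkt : ∀ j, n ≤ j → k ≤ (A.macroRun τ D w j).1.length + 1)
    (hbad : (∃ᶠ j in atTop, k ∈ bad (A.stepRun τ D w j)) ∨ Fintype.card Q < k) (v : ℕ) :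
    ∀ j, n ≤ j → ∀ p, ¬ A.LeftmostLive w k (A.macroRun τ D w j).1 j p v := by
  induction v using Nat.strong_induction_on with
  | _ v ih =>
    intro j hj p hp
    have hstep : ∀ i, n ≤ i → ∀ q, A.LeftmostLive w k (A.macroRun τ D w i).1 i q v →
        ∀ q' ∈ A.next q (w i), A.Live w (i + 1) q' →
        ¬ (k ∈ bad (A.stepRun τ D w i) ∧ v < 2 * Fintype.card Q + 1) ∧
        ∃ q'', A.LeftmostLive w k (A.macroRun τ D w (i + 1)).1 (i + 1) q'' v ∧
          (q'' = q' ∧ q' ∉ A.acc ∨ v < 2 * Fintype.card Q + 1) := by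
      intro i hi q hq q' hqq hq'
      obtain ⟨q'', v', h1, h2, h3, h4⟩ :=
        hD.leftmostLive_succ hk1 (hk i hi) (hkt i hi) hq hqq hq'
      obtain rfl : v' = v := by
        by_contra hne
        exact ih v' (lt_of_le_of_ne h2 hne) (i + 1) (by omega) q'' h1
      exact ⟨fun h => lt_irrefl _ (h3 h.1 h.2), q'', h1, h4⟩
    by_cases hv : v < 2 * Fintype.card Q + 1
    · rcases hbad with hbad | hbad
      · have hall : ∀ i, ∃ q, A.LeftmostLive w k (A.macroRun τ D w (j + i)).1 (j + i) q v := by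
          intro i
          induction i with
          | zero => exact ⟨p, hp⟩
          | succ i ihi =>
            obtain ⟨q, hq⟩ := ihi
            obtain ⟨q', hqq, hq'⟩ : ∃ q' ∈ A.next q (w (j + i)), A.Live w (j + i + 1) q' := by
              obtain ⟨L, S, r, R, -, -, -, h, -⟩ := hq
              exact h.exists_next
            obtain ⟨-, q'', h, -⟩ := hstep (j + i) (by omega) q hq q' hqq hq'
            exact ⟨q'', h⟩
        obtain ⟨b, hb, hbk⟩ := frequently_atTop.1 hbad j
        obtain ⟨i, rfl⟩ := Nat.exists_eq_add_of_le hb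
        obtain ⟨q, hq⟩ := hall i
        obtain ⟨q', hqq, hq'⟩ : ∃ q' ∈ A.next q (w (j + i)), A.Live w (j + i + 1) q' := by
          obtain ⟨L, S, r, R, -, -, -, h, -⟩ := hq
          exact h.exists_next
        exact (hstep (j + i) (by omega) q hq q' hqq hq').1 ⟨hbk, hv⟩
      · -- The ranks of a macrostate are at most `|Q|`, so no segment has ranks `≥ k`.
        obtain ⟨L, S, r, R, ht, -, -, -, rfl⟩ := hp
        obtain ⟨h1, h2⟩ := segMin_mem hv
        have h3 : segMin k (2 * Fintype.card Q + 1) (r :: R.map Prod.snd) ∈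
            (A.macroRun τ D w j).1.map Prod.snd := by
          rw [ht, List.map_append, List.map_cons]
          exact List.mem_append_right _ h1
        have h4 := ((A.macroRun τ D w j).2.mem_ranks.1 h3).2
        have h5 := (A.macroRun τ D w j).2.length_le
        omega
    · -- The leftmost live set has rank `< k` forever, and so it has no live accepting successors.
      obtain ⟨ρ, rfl, hρ, hlive, hF⟩ : ∃ ρ : ℕ → Q, ρ 0 = p ∧
          (∀ i, ρ (i + 1) ∈ A.next (ρ i) (w (j + i))) ∧
          (∀ i, A.Live w (j + i) (ρ i)) ∧ ∃ᶠ i in atTop, ρ i ∈ A.acc := by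
        obtain ⟨L, S, r, R, -, -, -, h, -⟩ := hp
        exact h.exists_run
      have hall : ∀ i, A.LeftmostLive w k (A.macroRun τ D w (j + i)).1 (j + i) (ρ i) v ∧
          ρ (i + 1) ∉ A.acc := by
        intro i
        have hnext : A.LeftmostLive w k (A.macroRun τ D w (j + i)).1 (j + i) (ρ i) v →
            A.LeftmostLive w k (A.macroRun τ D w (j + i + 1)).1 (j + i + 1) (ρ (i + 1)) v ∧
              ρ (i + 1) ∉ A.acc := by
          intro h
          obtain ⟨-, q, hq, ⟨rfl, hacc⟩ | hlt⟩ :=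
            hstep (j + i) (by omega) (ρ i) h (ρ (i + 1)) (hρ i) (hlive (i + 1))
          · exact ⟨hq, hacc⟩
          · exact absurd hlt hv
        have hleft : A.LeftmostLive w k (A.macroRun τ D w (j + i)).1 (j + i) (ρ i) v := by
          clear hnext
          induction i with
          | zero => exact hp
          | succ i ihi =>
            obtain ⟨-, q, hq, ⟨rfl, -⟩ | hlt⟩ :=
              hstep (j + i) (by omega) (ρ i) ihi (ρ (i + 1)) (hρ i) (hlive (i + 1))
            · exact hq
            · exact absurd hlt hv
        exact ⟨hleft, (hnext hleft).2⟩
      obtain ⟨b, hb, hbF⟩ := frequently_atTop.1 hF 1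
      obtain ⟨i, rfl⟩ := Nat.exists_eq_add_of_le' hb
      exact (hall i).2 hbF

theorem eventually_le_of_isLeast {f : ℕ → ℕ} {e : ℕ}
    (h : IsLeast {x | ∃ᶠ j in atTop, f j = x} e) : ∀ᶠ j in atTop, e ≤ f j := by
  have h1 : ∀ x ∈ Finset.range e, ∀ᶠ j in atTop, f j ≠ x := by
    intro x hx
    by_contra hc
    have h2 : e ≤ x := h.2 (by simpa [Filter.Frequently] using hc)
    exact absurd (Finset.mem_range.1 hx) (by omega)
  filter_upwards [(Filter.eventually_all_finset _).2 h1] with j hj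
  by_contra hlt
  exact hj (f j) (Finset.mem_range.2 (by omega)) rfl

theorem exists_isLeast_frequently {f : ℕ → ℕ} {n : ℕ} (hf : ∀ j, f j ≤ n) :
    ∃ e, IsLeast {x | ∃ᶠ j in atTop, f j = x} e := by
  have hne : ∃ x, ∃ᶠ j in atTop, f j = x := by
    by_contra! hc
    have h1 : ∀ x ∈ Finset.range (n + 1), ∀ᶠ j in atTop, f j ≠ x := fun x _ => by
      simpa [Filter.Frequently] using hc x
    obtain ⟨j, hj⟩ := ((Filter.eventually_all_finset _).2 h1).exists
    exact hj (f j) (Finset.mem_range.2 (Nat.lt_succ_of_le (hf j))) rfl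
  classical
  exact ⟨Nat.find hne, Nat.find_spec hne, fun x hx => Nat.find_min' hne hx⟩

theorem Admissible.lang_subset (hD : A.Admissible D) :
    A.lang A.start ⊆ (A.determinizeOmitting τ D).lang := by
  intro w hw
  obtain ⟨e, he⟩ := exists_isLeast_frequently (f := fun j => priority (A.stepRun τ D w j))
    (n := 2 * (2 * Fintype.card Q + 1)) (fun j => by
      have := (domRank_stepRun_bounds (τ := τ) (D := D) (w := w) j).2
      simp only [priority]
      split_ifs <;> omega)
  refine ⟨e, ?_, he⟩
  -- An odd value `2 k - 1` stems from a bad event of `k`, or from `k = |Q| + 1` and no event.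
  by_contra hodd
  obtain ⟨k, hk1, hke⟩ : ∃ k, 1 ≤ k ∧ e = 2 * k - 1 := by
    rw [Nat.not_even_iff_odd] at hodd
    obtain ⟨c, hc⟩ := hodd
    exact ⟨c + 1, by omega, by omega⟩
  have hfreq : ∃ᶠ j in atTop, domRank (A.stepRun τ D w j) = k ∧
      domRank (A.stepRun τ D w j) ∉ good (A.stepRun τ D w j) := by
    refine (show ∃ᶠ j in atTop, priority (A.stepRun τ D w j) = e from he.1).mono ?_
    intro j hj
    have h1 := (domRank_stepRun_bounds (τ := τ) (D := D) (w := w) j).1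
    simp only [priority] at hj
    split_ifs at hj with hg
    · omega
    · exact ⟨by omega, hg⟩
  have hev : ∀ᶠ j in atTop, k ≤ domRank (A.stepRun τ D w j) := by
    filter_upwards [eventually_le_of_isLeast he] with j hj
    simp only [priority] at hj
    split_ifs at hj <;> omega
  obtain ⟨n, hn⟩ := eventually_atTop.1 hev
  have hbad : (∃ᶠ j in atTop, k ∈ bad (A.stepRun τ D w j)) ∨ Fintype.card Q < k := by
    by_cases hkc : Fintype.card Q < k
    · exact Or.inr hkc
    · refine Or.inl (hfreq.mono ?_)
      rintro j ⟨rfl, hg⟩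
      have h2 := (domRank_mem (A.stepRun τ D w j)).resolve_right (by omega)
      exact (Finset.mem_union.1 h2).resolve_left hg
  -- The number of sets at least doubles until all ranks below `k` are present.
  have hlen : ∀ i, min (i + 1) (k - 1) ≤ (A.macroRun τ D w (n + i)).1.length := by
    intro i
    induction i with
    | zero =>
      obtain ⟨q, hq, -⟩ := hD.exists_live (τ := τ) hw n
      have h1 := idx_lt_length.2 hq
      change min (0 + 1) (k - 1) ≤ (A.macroRun τ D w n).1.length
      omega
    | succ i ih =>
      have h1 := hn (n + i) (by omega)
      refine length_macroRun_succ (j := n + i) (by omega) (fun hb => ?_) (by omega)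
      have := domRank_le (Finset.mem_union_right (good (A.stepRun τ D w (n + i))) hb)
      omega
  obtain ⟨L, S, r, R, q, ht, hdead, hq, hlive⟩ :=
    exists_leftmost (hD.exists_live (τ := τ) hw (n + k))
  refine hD.not_leftmostLive (τ := τ) (w := w) (n := n + k) hk1 (fun j hj => hn j (by omega))
    (fun j hj => ?_) hbad _ (n + k) le_rfl q ⟨L, S, r, R, ht, hdead, hq, hlive, rfl⟩
  have := hlen (j - n)
  rw [Nat.add_sub_cancel' (by omega)] at this
  omega

/-! ### Soundness: the run of the construction as a rank trace -/

theorem rankTrace_macroRun {k n : ℕ} (hk1 : 1 ≤ k)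
    (hk : ∀ j, n ≤ j → k ≤ domRank (A.stepRun τ D w j))
    (hbad : ∀ j, n ≤ j → k ∉ bad (A.stepRun τ D w j))
    (hkt : ∀ j, n ≤ j → k ≤ (A.macroRun τ D w j).1.length)
    (hgood : ∃ᶠ j in atTop, k ∈ good (A.stepRun τ D w j)) :
    RankTrace A (fun j => w (n + j)) (fun j => (A.macroRun τ D w (n + j)).1) k
      (fun j => k ∈ good (A.stepRun τ D w (n + j))) := by
  have hup : ∀ j, upto (A.succMacro τ (A.macroRun τ D w (n + j)) (w (n + j))).1 k ⊆
      A.post (w (n + j)) (upto (A.macroRun τ D w (n + j)).1 k) := fun j =>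
    upto_next_subset (A.macroRun τ D w (n + j)).2 (τ.fresh_perm _ _) (τ.isGrouping _ _) hk1
      (hkt _ (by omega)) (hk _ (by omega)) (hbad _ (by omega))
  have hex : ∀ j, ∃ q ∈ states (A.succMacro τ (A.macroRun τ D w (n + j)) (w (n + j))).1,
      idx (A.succMacro τ (A.macroRun τ D w (n + j)) (w (n + j))).1 q =
        rankIdx (A.succMacro τ (A.macroRun τ D w (n + j)) (w (n + j))).1 k := fun j =>
    exists_idx_eq_rankIdx (A.macroRun τ D w (n + j)).2 (τ.fresh_perm _ _) (τ.isGrouping _ _) hk1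
      (hkt _ (by omega)) (hk _ (by omega)) (hbad _ (by omega))
  have hidx : ∀ {j q}, q ∈ states (A.macroRun τ D w (n + (j + 1))).1 →
      idx (A.macroRun τ D w (n + (j + 1))).1 q =
        idx (A.succMacro τ (A.macroRun τ D w (n + j)) (w (n + j))).1 q := by
    intro j q hq
    rw [← Nat.add_assoc, macroRun_succ] at hq ⊢
    rw [states_without, Finset.mem_sdiff] at hq
    exact idx_without hq.2
  have hrank : ∀ j, rankIdx (A.macroRun τ D w (n + (j + 1))).1 k =
      rankIdx (A.succMacro τ (A.macroRun τ D w (n + j)) (w (n + j))).1 k := fun j =>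
    rankIdx_without _ _ _
  have hle : ∀ {j q q' p p'}, SliceSucc A (w (n + j)) (A.macroRun τ D w (n + j)).1 q q' →
      q' ∉ A.acc → p ∈ states (A.macroRun τ D w (n + j)).1 → p' ∈ A.next p (w (n + j)) →
      idx (A.macroRun τ D w (n + j)).1 p ≤ idx (A.macroRun τ D w (n + j)).1 q →
      idx (A.succMacro τ (A.macroRun τ D w (n + j)) (w (n + j))).1 p' ≤
        idx (A.succMacro τ (A.macroRun τ D w (n + j)) (w (n + j))).1 q' := fun h1 h2 h3 h4 h5 =>
    idx_le_of_sliceSucc (A.macroRun τ D w (n + _)).2 (τ.fresh_perm _ _) (τ.isGrouping _ _)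
      h1 h2 h3 h4 h5
  refine ⟨fun j => ?_, fun j q hq => ?_, ?_, ?_, ?_, ?_⟩
  · obtain ⟨q, hq, hqk⟩ := hex j
    obtain ⟨p, hp, -⟩ := mem_post.1 (hup j (mem_upto.2 ⟨hq, hqk.le⟩))
    exact ⟨p, hp⟩
  · exact hup j (mem_upto_without.1 hq).1
  · intro j q q' p p' h1 h2 h3 h4 h5 h6 h7
    rw [hidx h3, hidx h6]
    exact hle h1 h2 h4 h5 h7
  · intro j q q' h1 h2 h3 h4
    rw [hidx h3, hrank] at h4
    obtain ⟨p', hp', hpk⟩ := hex j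
    obtain ⟨p, hp, hpp⟩ := mem_post.1 (hup j (mem_upto.2 ⟨hp', hpk.le⟩))
    refine ⟨p, hp, ?_⟩
    by_contra hlt
    have := hle h1 h2 (mem_upto.1 hp).1 hpp (not_lt.1 hlt)
    omega
  · intro j q q' h1 h2 h3 h4
    rw [hidx h3, hrank]
    exact idx_eq_rankIdx_of_sliceSucc (A.macroRun τ D w (n + j)).2 (τ.fresh_perm _ _)
      (τ.isGrouping _ _) hk1 (hkt _ (by omega)) (hk _ (by omega)) (hbad _ (by omega)) h1 h2 h4
  · simpa only [Nat.add_comm n] using (frequently_add_iff n).2 hgood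

theorem lang_determinizeOmitting_subset :
    (A.determinizeOmitting τ D).lang ⊆ A.lang A.start := by
  rintro w ⟨e, heven, he⟩
  have he' : IsLeast {x | ∃ᶠ j in atTop, priority (A.stepRun τ D w j) = x} e := he
  obtain ⟨k, hke⟩ := heven.two_dvd
  have hfreq : ∃ᶠ j in atTop, domRank (A.stepRun τ D w j) = k ∧ k ∈ good (A.stepRun τ D w j) := by
    refine (show ∃ᶠ j in atTop, priority (A.stepRun τ D w j) = e from he'.1).mono ?_
    intro j hj
    have h1 := (domRank_stepRun_bounds (τ := τ) (D := D) (w := w) j).1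
    simp only [priority] at hj
    split_ifs at hj with hg
    · obtain rfl : domRank (A.stepRun τ D w j) = k := by omega
      exact ⟨rfl, hg⟩
    · omega
  have hev : ∀ᶠ j in atTop, k ≤ domRank (A.stepRun τ D w j) ∧ k ∉ bad (A.stepRun τ D w j) := by
    filter_upwards [eventually_le_of_isLeast he'] with j hj
    have h1 := (domRank_stepRun_bounds (τ := τ) (D := D) (w := w) j).1
    simp only [priority] at hj
    split_ifs at hj with hg
    · refine ⟨by omega, fun hb => ?_⟩
      have h2 := domRank_le (Finset.mem_union_right (good (A.stepRun τ D w j)) hb)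
      obtain rfl : domRank (A.stepRun τ D w j) = k := by omega
      exact notMem_bad_of_mem_good hg hb
    · refine ⟨by omega, fun hb => ?_⟩
      have h2 := domRank_le (Finset.mem_union_right (good (A.stepRun τ D w j)) hb)
      omega
  obtain ⟨n, hn⟩ := eventually_atTop.1 hev
  obtain ⟨m, hm, hmk, hmg⟩ := frequently_atTop.1 hfreq n
  have hk1 : 1 ≤ k := hmk ▸ (domRank_stepRun_bounds m).1
  have hlen : ∀ i, k ≤ (A.macroRun τ D w (m + 1 + i)).1.length := by
    intro i
    induction i with
    | zero =>
      refine length_macroRun_succ (hn m hm).1 (hn m hm).2 ?_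
      have h1 := prune_ranks_subset _ _ (mem_good.1 hmg).1
      exact ((mem_ranks_step A (w m) (A.macroRun τ D w m).2 (τ.fresh_perm _ _)).1 h1).2
    | succ i ih =>
      have h1 := hn (m + 1 + i) (by omega)
      exact length_macroRun_succ (j := m + 1 + i) h1.1 h1.2 (by omega)
  obtain ⟨j, ρ, h0, h1, hF⟩ := (rankTrace_macroRun (τ := τ) (D := D) (w := w) (n := m + 1) hk1
    (fun j hj => (hn j (by omega)).1) (fun j hj => (hn j (by omega)).2)
    (fun j hj => by
      have := hlen (j - (m + 1))
      rwa [Nat.add_sub_cancel' hj] at this)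
    (hfreq.mono fun _ h => h.2)).exists_run
  exact live_of_mem_macroRun h0
    (live_of_run (fun i => by simpa only [Nat.add_assoc] using h1 i) hF)

theorem Admissible.lang_determinizeOmitting (hD : A.Admissible D) :
    (A.determinizeOmitting τ D).lang = A.lang A.start :=
  lang_determinizeOmitting_subset.antisymm hD.lang_subset

theorem determinizeOmitting_empty (σ : Resolution A) :
    A.determinizeOmitting σ (fun _ => ∅) = A.determinize σ := by
  have h : ∀ m : Macrostate Q, m.without ∅ = m := fun m =>
    Subtype.ext (by simp [Macrostate.without, without])
  simp only [determinizeOmitting, determinize, h]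

end NBA

theorem theorem1 {Q X : Type*} [DecidableEq Q] [Fintype Q] (A : NBA Q X)
    (σ τ : Resolution A) (D : Macrostate Q → Finset Q)
    (hD : ∀ m : Macrostate Q, m.1.IsSlice → ∀ p ∈ D m, ∃ q : Q,
      A.lang {p} ⊆ A.lang {q} ∧ p ∈ m.1.states ∧ q ∈ m.1.states ∧ m.1.idx q < m.1.idx p) :
    (A.determinizeOmitting τ D).lang = (A.determinize σ).lang := by
  have h : A.Admissible fun _ => ∅ := fun _ _ _ hp => absurd hp (Finset.notMem_empty _)
  rw [NBA.Admissible.lang_determinizeOmitting hD, ← NBA.determinizeOmitting_empty σ,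
    h.lang_determinizeOmitting]
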